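/- **Conventions.** All manifolds, maps, bundles and sections are smooth, manifolds are Hausdorff and without boundary, and affine connections are torsion-free. Let $r\ge 1$, $n\ge 0$, let $\tilde\nabla$ be the flat connection of $\mathbf R^{n+r}$ and let $\omega$ be a volume element of $\mathbf R^{n+r}$ (a non-zero constant $(n+r)$-form). *Equiaffine immersions.* An equiaffine structure on an $n$-manifold $M$ is a pair $(\nabla,\theta)$ of an affine connection $\nabla$ and a volume element $\theta$ (a nowhere vanishing $n$-form) with $\nabla\theta=0$; $M$ is oriented by $\theta$. An immersion $f:(M,\nabla,\theta)\to(\mathbf R^{n+r},\tilde\nabla,\omega)$ is *equiaffine* if there are a transversal bundle $N$ (a vector bundle over $M$ with $\mathbf R^{n+r}=df(T_pM)\oplus N_p$ for all $p\in M$) and a volume element $\theta^\perp$ on $N$ that induce $(\nabla,\theta)$, that is, $$\tilde\nabla_X\,df(Y)-df(\nabla_XY)\in N,\qquad \theta(X_1,\dots,X_n)=\frac{\omega(df(X_1),\dots,df(X_n),\xi_1,\dots,\xi_r)}{\theta^\perp(\xi_1,\dots,\xi_r)}$$ for all vector fields $X,Y,X_i$ on $M$ and every frame $(\xi_j)$ of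 $N$. Fix such a pair and let $\alpha(X,Y)=\tilde\nabla_X\,df(Y)-df(\nabla_XY)$. *Unit ellipsoids.* For $\phi\in\bigwedge^{n+r-1}\mathbf R^{n+r}$ let $\tilde h_\phi(v)=\omega(\phi,v)$, that is, $\tilde h_\phi(v)=\omega(v_1,\dots,v_{n+r-1},v)$ if $\phi=v_1\wedge\dots\wedge v_{n+r-1}$. Let $\omega'$ be the volume element of $\bigwedge^{n+r-1}\mathbf R^{n+r}$ such that, for every basis $(v_i)$ of $\mathbf R^{n+r}$ with $\omega(v_1,\dots,v_{n+r})=1$, $$\omega'(\widehat{v_1}\wedge v_2\wedge\dots\wedge v_{n+r},\ \dots,\ v_1\wedge\dots\wedge v_{n+r-1}\wedge\widehat{v_{n+r}})=(-1)^{(n+r)(n+r-1)/2}.$$ A *unit ellipsoid* is a set $S=\{\sum_i a_i\zeta_i : \sum_i a_i^2=1\}$ for a basis $(\zeta_1,\dots,\zeta_{n+r})$ of $\bigwedge^{n+r-1}\mathbf R^{n+r}$ with $\omega'(\zeta_1,\dots,\zeta_{n+r})=1$. *Total absolute curvature.* For $p\in M$ let $\tilde\nu_N(\eta)=\theta(e_1,\dots,e_n)^{-1}\,df(e_1)\wedge\dots\wedge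 df(e_n)\wedge\eta$ for $\eta\in\bigwedge^{r-1}N_p$, where $(e_i)$ is any frame of $T_pM$; let $B_p=\{\eta\in\bigwedge^{r-1}N_p:\tilde\nu_N(\eta)\in S\}$ and $B=\bigcup_pB_p$. For $\eta\in B_p$ let $$G(\eta)=(-1)^n\,\theta(e_1,\dots,e_n)^{-2}\,\det\big[\tilde h_{\tilde\nu_N(\eta)}(\alpha(e_i,e_j))\big]_{1\le i,j\le n}.$$ Let $(\theta^\perp)'$ be the volume element on $\bigwedge^{r-1}N_p$ obtained from $\theta^\perp$ as $\omega'$ was from $\omega$; give $B_p$ the volume element $\omega_{B_p}=(\theta^\perp)'(\eta,\cdot,\dots,\cdot)$ at $\eta\in B_p$, and $B$ the volume element $\omega_B=\pi^*\theta\wedge\omega_{B_p}$, where $\pi:B\to M$ is the projection. The *total absolute curvature* of $f$ with respect to $S$ is $$\tau_S(f)=\frac1{\operatorname{vol}(\mathcal S^{n+r-1}(1))}\int_B|G|\,|\omega_B| ,$$ where $\mathcal S^{n+r-1}(1)$ is the Euclidean unit sphere. **Theorem.** Let $M$ be a compact oriented $n$-manifold with an equiaffine structure $(\nabla,\theta)$,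 let $f:(M,\nabla,\theta)\to(\mathbf R^{n+r},\tilde\nabla,\omega)$ be an equiaffine immersion, let $(N,\theta^\perp)$ be any pair inducing $(\nabla,\theta)$, and let $S$ be any unit ellipsoid. If $\tau_S(f)=2$, then $f(M)$ is contained in an $(n+1)$-dimensional affine subspace of $\mathbf R^{n+r}$. -/

import Mathlib

open scoped Manifold ContDiff ENNReal

noncomputable section

namespace EquiaffineGeometry

/-! ### Volume elements, height functions and unit ellipsoids -/

section Linear

variable {V : Type*} [AddCommGroup V] [Module ℝ V] {m : ℕ}

/-- The height function `h̃_φ` of `φ ∈ ⋀ᵐ V`, `dim V = m + 1`, with respect to the volume element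
`Ω`: the linear function `v ↦ Ω(φ, v)`, that is, `v ↦ Ω(v₁, …, v_m, v)` for `φ = v₁ ∧ ⋯ ∧ v_m`
(see `height_ιMulti` and `height_projection`). -/
def height (Ω : V [⋀^Fin (m + 1)]→ₗ[ℝ] ℝ) : ⋀[ℝ]^m V →ₗ[ℝ] V →ₗ[ℝ] ℝ :=
  ((-1 : ℝ) ^ m • (exteriorPower.alternatingMapLinearEquiv.toLinearMap ∘ₗ Ω.curryLeft)).flip

/-- For a family `v₀, …, v_m`, the family of the `v₀ ∧ ⋯ ∧ v̂ᵢ ∧ ⋯ ∧ v_m` (omit `vᵢ`) in `⋀ᵐ V`. -/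
def omitWedge (v : Fin (m + 1) → V) (i : Fin (m + 1)) : ⋀[ℝ]^m V :=
  exteriorPower.ιMulti ℝ m fun j => v (i.succAbove j)

/-- A family of vectors on which the volume element `Ω` takes the value `1`. -/
def unimodularFrame {d : ℕ} (Ω : V [⋀^Fin d]→ₗ[ℝ] ℝ) : Fin d → V :=
  Classical.epsilon fun v => Ω v = 1

/-- The volume element `Ω'` on `⋀ᵐ V`, `dim V = m + 1`, induced by the volume element `Ω` on `V`.
It is the alternating form whose value on the family `v̂₀ ∧ ⋯ ∧ v_m, …, v₀ ∧ ⋯ ∧ v̂_m` is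
`(-1)^((m + 1) m / 2)` whenever `Ω(v₀, …, v_m) = 1` (see `dualVolume_omitWedge`); it is built as
`Ω'(φ₀, …, φ_m) = det (h̃_{φᵢ}(vⱼ))` with a family `v` such that `Ω(v) = 1`. -/
def dualVolume (Ω : V [⋀^Fin (m + 1)]→ₗ[ℝ] ℝ) : (⋀[ℝ]^m V) [⋀^Fin (m + 1)]→ₗ[ℝ] ℝ :=
  (Matrix.detRowAlternating (R := ℝ) (n := Fin (m + 1))).compLinearMap
    (LinearMap.pi fun j => (height Ω).flip (unimodularFrame Ω j))

/-- A unit ellipsoid in `⋀ᵐ V`, `dim V = m + 1`, given by a basis `ζ` with `Ω'(ζ) = 1`. -/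
structure UnitEllipsoid (Ω : V [⋀^Fin (m + 1)]→ₗ[ℝ] ℝ) where
  basis : Module.Basis (Fin (m + 1)) ℝ (⋀[ℝ]^m V)
  dualVolume_basis : dualVolume Ω basis = 1

/-- The quadratic form `∑ aᵢ ζᵢ ↦ ∑ aᵢ²`. -/
def UnitEllipsoid.sq {Ω : V [⋀^Fin (m + 1)]→ₗ[ℝ] ℝ} (S : UnitEllipsoid Ω) (φ : ⋀[ℝ]^m V) : ℝ :=
  ∑ i, S.basis.repr φ i ^ 2

/-- The ellipsoid itself, the set of the `∑ aᵢ ζᵢ` with `∑ aᵢ² = 1`. -/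
def UnitEllipsoid.carrier {Ω : V [⋀^Fin (m + 1)]→ₗ[ℝ] ℝ} (S : UnitEllipsoid Ω) :
    Set (⋀[ℝ]^m V) :=
  {φ | S.sq φ = 1}

theorem height_cons (Ω : V [⋀^Fin (m + 1)]→ₗ[ℝ] ℝ) (w : Fin m → V) (v : V) :
    height Ω (exteriorPower.ιMulti ℝ m w) v = (-1) ^ m * Ω (Matrix.vecCons v w) := by
  simp [height]

theorem height_ιMulti (Ω : V [⋀^Fin (m + 1)]→ₗ[ℝ] ℝ) (w : Fin m → V) (v : V) :
    height Ω (exteriorPower.ιMulti ℝ m w) v = Ω (Fin.snoc w v) := by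
  have h : (Fin.snoc w v : Fin (m + 1) → V) = Matrix.vecCons v w ∘ finRotate (m + 1) := by
    funext i
    simpa [Matrix.vecCons] using congrFun (Fin.snoc_eq_cons_rotate w v) i
  rw [height_cons, h, AlternatingMap.map_perm, sign_finRotate]
  rcases Nat.even_or_odd m with hm | hm <;> simp [hm.neg_one_pow]

theorem height_omitWedge (Ω : V [⋀^Fin (m + 1)]→ₗ[ℝ] ℝ) (v : Fin (m + 1) → V)
    (i j : Fin (m + 1)) :
    height Ω (omitWedge v i) (v j) = if i = j then (-1) ^ (m - (i : ℕ)) * Ω v else 0 := by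
  rw [omitWedge, height_cons]
  split_ifs with h
  · subst h
    have h1 := Ω.map_insertNth i (v i) (fun j => v (i.succAbove j))
    have h2 : i.insertNth (v i) (fun j => v (i.succAbove j)) = v := Fin.insertNth_self_removeNth i v
    rw [h2] at h1
    have h3 : ((-1 : ℝ)) ^ m = (-1) ^ (m - (i : ℕ)) * (-1) ^ (i : ℕ) := by
      rw [← pow_add, Nat.sub_add_cancel (Nat.lt_succ_iff.mp i.2)]
    rw [h1, h3, zsmul_eq_mul]
    push_cast
    ring
  · obtain ⟨l, hl⟩ := Fin.exists_succAbove_eq (Ne.symm h)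
    rw [Ω.map_eq_zero_of_eq (i := 0) (j := l.succ) _ (by simp [hl]) (Fin.succ_ne_zero l).symm,
      mul_zero]

/-- If `φ = v₁ ∧ ⋯ ∧ v_m` and `Ω(v₁, …, v_m, u) = 1`, then `h̃_φ(x) u` is the projection of `x` to
the line of `u` along the span of `v₁, …, v_m`. -/
theorem height_projection (hV : Module.finrank ℝ V = m + 1) (Ω : V [⋀^Fin (m + 1)]→ₗ[ℝ] ℝ)
    (w : Fin m → V) (u : V) (hu : Ω (Fin.snoc w u) = 1) (x : V) :
    x - height Ω (exteriorPower.ιMulti ℝ m w) x • u ∈ Submodule.span ℝ (Set.range w) := by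
  have hli : LinearIndependent ℝ (Fin.snoc w u : Fin (m + 1) → V) := by
    by_contra h
    rw [Ω.map_linearDependent _ h] at hu
    exact zero_ne_one hu
  have hx : x ∈ Submodule.span ℝ (Set.range (Fin.snoc w u : Fin (m + 1) → V)) := by
    rw [hli.span_eq_top_of_card_eq_finrank (by simp [hV])]
    trivial
  rw [Fin.range_snoc, Submodule.mem_span_insert] at hx
  obtain ⟨a, z, hz, rfl⟩ := hx
  have hz0 : height Ω (exteriorPower.ιMulti ℝ m w) z = 0 := by
    refine Submodule.span_induction (p := fun z _ => height Ω (exteriorPower.ιMulti ℝ m w) z = 0)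
      ?_ (by simp) (fun a b _ _ ha hb => by simp [ha, hb]) (fun c a _ ha => by simp [ha]) hz
    rintro _ ⟨i, rfl⟩
    rw [height_cons, Ω.map_eq_zero_of_eq (i := 0) (j := i.succ) _ (by simp)
      (Fin.succ_ne_zero i).symm, mul_zero]
  simpa [height_ιMulti Ω w u, hu, hz0] using hz

/-- The defining property of `Ω'`. -/
theorem dualVolume_omitWedge (hV : Module.finrank ℝ V = m + 1) (Ω : V [⋀^Fin (m + 1)]→ₗ[ℝ] ℝ)
    (v : Fin (m + 1) → V) (hv : Ω v = 1) :
    dualVolume Ω (omitWedge v) = (-1) ^ ((m + 1) * m / 2) := by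
  have hli : LinearIndependent ℝ v := by
    by_contra h
    rw [Ω.map_linearDependent _ h] at hv
    exact zero_ne_one hv
  let b := basisOfLinearIndependentOfCardEqFinrank hli (by simp [hV])
  have hb : ⇑b = v := coe_basisOfLinearIndependentOfCardEqFinrank hli _
  have hu : Ω (unimodularFrame Ω) = 1 := Classical.epsilon_spec (p := fun v => Ω v = 1) ⟨v, hv⟩
  have hdet : (b.toMatrix (unimodularFrame Ω)).det = 1 := by
    have h := congrArg (fun g => g (unimodularFrame Ω)) (Ω.eq_smul_basis_det b)
    simpa [hu, hb, hv, Module.Basis.det_apply] using h.symm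
  have key : (Matrix.of fun i j => height Ω (omitWedge v i) (unimodularFrame Ω j)) =
      Matrix.diagonal (fun i : Fin (m + 1) => (-1 : ℝ) ^ (m - (i : ℕ))) *
        b.toMatrix (unimodularFrame Ω) := by
    ext i j
    rw [Matrix.diagonal_mul, Matrix.of_apply]
    conv_lhs => rw [← b.sum_repr (unimodularFrame Ω j)]
    simp [hb, height_omitWedge, hv, Module.Basis.toMatrix_apply, mul_comm]
  have h1 : dualVolume Ω (omitWedge v) =
      (Matrix.of fun i j => height Ω (omitWedge v i) (unimodularFrame Ω j)).det := rfl
  rw [h1, key, Matrix.det_mul, hdet, mul_one, Matrix.det_diagonal, Finset.prod_pow_eq_pow_sum,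
    Fin.sum_univ_eq_sum_range (fun i => m - i)]
  have h2 := Finset.sum_range_reflect (fun i => i) (m + 1)
  rw [Finset.sum_range_id] at h2
  exact congrArg (fun e => (-1 : ℝ) ^ e) h2

end Linear

/-! ### Equiaffine structures -/

section Manifold

variable {n : ℕ} {M : Type*} [TopologicalSpace M] [ChartedSpace (EuclideanSpace ℝ (Fin n)) M]

variable [IsManifold (𝓡 n) ∞ M]

/-- `Y` is a smooth vector field on `M`. -/
def IsSmoothField (Y : Π p : M, TangentSpace (𝓡 n) p) : Prop :=
  ContMDiff (𝓡 n) ((𝓡 n).prod 𝓘(ℝ, EuclideanSpace ℝ (Fin n))) ∞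
    fun p => (⟨p, Y p⟩ : TangentBundle (𝓡 n) M)

variable (n M) in
/-- An equiaffine structure `(∇, θ)`: a smooth torsion-free affine connection `∇` and a smooth
volume element `θ` (a nowhere vanishing `n`-form, which also orients `M`) with `∇θ = 0`. -/
structure EquiaffineStructure where
  /-- The connection; `conn Y p x` is `(∇_x Y)(p)`. -/
  conn : CovariantDerivative (𝓡 n) (EuclideanSpace ℝ (Fin n))
    (TangentSpace (𝓡 n) : M → Type _)
  smooth_conn : CovariantDerivative.ContMDiffCovariantDerivative conn ∞
  torsion_eq_zero : conn.torsion = 0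
  vol : Π p : M, (TangentSpace (𝓡 n) p) [⋀^Fin n]→ₗ[ℝ] ℝ
  vol_ne_zero : ∀ p, vol p ≠ 0
  smooth_vol : ∀ Y : Fin n → Π p : M, TangentSpace (𝓡 n) p, (∀ i, IsSmoothField (Y i)) →
    ContMDiff (𝓡 n) 𝓘(ℝ) ∞ fun p => vol p fun i => Y i p
  /-- `x(θ(Y₁, …, Yₙ)) = ∑ᵢ θ(Y₁, …, ∇_x Yᵢ, …, Yₙ)` -/
  parallel_vol : ∀ Y : Fin n → Π p : M, TangentSpace (𝓡 n) p, (∀ i, IsSmoothField (Y i)) →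
    ∀ (p : M) (x : TangentSpace (𝓡 n) p),
      mvfderiv (𝓡 n) (fun q => vol q fun i => Y i q) p x =
        ∑ i, vol p (Function.update (fun j => Y j p) i (conn (Y i) p x))

/-- The Borel measure on the chart domain around `c` given by the volume element `θ`: the image
under the inverse chart of the measure with Lebesgue density `|θ(∂₁, …, ∂ₙ)|`. -/
def chartVolume [MeasurableSpace M] (θ : Π p : M, (TangentSpace (𝓡 n) p) [⋀^Fin n]→ₗ[ℝ] ℝ)
    (c : M) : MeasureTheory.Measure M :=
  let e := chartAt (EuclideanSpace ℝ (Fin n)) c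
  ((MeasureTheory.volume.restrict e.target).withDensity fun u =>
    ‖θ (e.symm u) fun i =>
      mfderiv 𝓘(ℝ, EuclideanSpace ℝ (Fin n)) (𝓡 n) e.symm u (EuclideanSpace.single i 1)‖ₑ).map
    e.symm

/-- The Borel measure on `M` given by the volume element `θ`. The measures `chartVolume θ c` are
restrictions to the chart domains of one measure, which is their supremum. -/
def volumeMeasure [MeasurableSpace M] (θ : Π p : M, (TangentSpace (𝓡 n) p) [⋀^Fin n]→ₗ[ℝ] ℝ) :
    MeasureTheory.Measure M :=
  ⨆ c : M, chartVolume θ c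

/-! ### Equiaffine immersions -/

variable {V : Type*} [NormedAddCommGroup V] [NormedSpace ℝ V] {k : ℕ}

variable (n)

/-- The differential `df_p : T_pM → V`. -/
def df (f : M → V) (p : M) : TangentSpace (𝓡 n) p →ₗ[ℝ] V :=
  (mvfderiv (𝓡 n) f p).toLinearMap

/-- `(∇̃_x df(Y))(p)`, where `∇̃` is the flat connection of `V`. -/
def flatDeriv (f : M → V) (Y : Π p : M, TangentSpace (𝓡 n) p) (p : M)
    (x : TangentSpace (𝓡 n) p) : V :=
  mvfderiv (𝓡 n) (fun q => df n f q (Y q)) p x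

/-- A pair `(N, θ^⊥)` for `f : M → V` in codimension `k + 1`: a smooth vector bundle `N` of rank
`k + 1` with `V = df(T_pM) ⊕ N_p` for all `p`, and a smooth volume element `θ^⊥` on `N`. -/
structure TransversalBundle (f : M → V) (k : ℕ) where
  fibre : M → Submodule ℝ V
  isCompl : ∀ p, IsCompl (LinearMap.range (df n f p)) (fibre p)
  exists_frame : ∀ p, ∃ U : Set M, IsOpen U ∧ p ∈ U ∧ ∃ ξ : Fin (k + 1) → M → V,
    (∀ i, ContMDiffOn (𝓡 n) 𝓘(ℝ, V) ∞ (ξ i) U) ∧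
    ∀ q ∈ U, LinearIndependent ℝ (fun i => ξ i q) ∧
      Submodule.span ℝ (Set.range fun i => ξ i q) = fibre q
  vol : Π p, (fibre p) [⋀^Fin (k + 1)]→ₗ[ℝ] ℝ
  vol_ne_zero : ∀ p, vol p ≠ 0
  smooth_vol : ∀ ξ : Fin (k + 1) → Π p, fibre p,
    (∀ i, ContMDiff (𝓡 n) 𝓘(ℝ, V) ∞ fun p => (ξ i p : V)) →
    ContMDiff (𝓡 n) 𝓘(ℝ) ∞ fun p => vol p fun i => ξ i p

variable {n} {f : M → V}

/-- The pair `(N, θ^⊥)` induces the equiaffine structure `(∇, θ)`: the `df(TM)`-component of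
`∇̃_x df(Y)` is `df(∇_x Y)`, and `θ(X₁, …, Xₙ) = Ω(df X₁, …, df Xₙ, ξ₁, …, ξᵣ) / θ^⊥(ξ₁, …, ξᵣ)` for
every frame `ξ` of `N`. -/
structure TransversalBundle.Induces (N : TransversalBundle n f k)
    (Ω : V [⋀^Fin (n + k + 1)]→ₗ[ℝ] ℝ) (E : EquiaffineStructure n M) : Prop where
  conn : ∀ Y : Π p : M, TangentSpace (𝓡 n) p, IsSmoothField Y →
    ∀ (p : M) (x : TangentSpace (𝓡 n) p),
      flatDeriv n f Y p x - df n f p (E.conn Y p x) ∈ N.fibre p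
  vol : ∀ (p : M) (X : Fin n → TangentSpace (𝓡 n) p) (ξ : Fin (k + 1) → N.fibre p),
    N.vol p ξ ≠ 0 →
      E.vol p X = Ω (Fin.append (n := k + 1) (fun i => df n f p (X i)) fun j => (ξ j : V)) / N.vol p ξ

/-- `f : (M, ∇, θ) → (V, ∇̃, Ω)` is an equiaffine immersion of codimension `k + 1`. -/
structure IsEquiaffineImmersion (f : M → V) (Ω : V [⋀^Fin (n + k + 1)]→ₗ[ℝ] ℝ)
    (E : EquiaffineStructure n M) : Prop where
  smooth : ContMDiff (𝓡 n) 𝓘(ℝ, V) ∞ f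
  injective_df : ∀ p : M, Function.Injective (df n f p)
  exists_induces : ∃ N : TransversalBundle n f k, N.Induces Ω E

/-! ### The Gauss map, the Lipschitz–Killing curvature, the total absolute curvature -/

namespace TransversalBundle

/-- The affine fundamental form `α(x, y)`: the `N`-component of `∇̃_x df(Y)` for any local vector
field `Y` extending `y`. -/
def fundamentalForm (N : TransversalBundle n f k) (p : M)
    (x y : TangentSpace (𝓡 n) p) : V :=
  (N.fibre p).projection (LinearMap.range (df n f p)) (N.isCompl p).symm
    (flatDeriv n f (FiberBundle.extend (EuclideanSpace ℝ (Fin n)) y) p x)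

/-- A frame of the tangent space at `p`. -/
def _root_.EquiaffineGeometry.EquiaffineStructure.frame (E : EquiaffineStructure n M) (p : M) :
    Fin n → TangentSpace (𝓡 n) p :=
  Classical.epsilon fun e => E.vol p e ≠ 0

/-- The map `ν̃_N(η) = df(e₁) ∧ ⋯ ∧ df(eₙ) ∧ η` on the fibre `⋀ᵏ N_p`, where `θ(e₁, …, eₙ) = 1`.
It is written with an arbitrary frame `e` as `θ(e)⁻¹ df(e₁) ∧ ⋯ ∧ df(eₙ) ∧ η`. -/
def gauss (N : TransversalBundle n f k) (E : EquiaffineStructure n M) (p : M) :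
    ⋀[ℝ]^k (N.fibre p) →ₗ[ℝ] ⋀[ℝ]^(n + k) V :=
  LinearMap.codRestrict (⋀[ℝ]^(n + k) V)
    ((E.vol p (E.frame p))⁻¹ •
      (LinearMap.mulLeft ℝ (ExteriorAlgebra.ιMulti ℝ n fun i => df n f p (E.frame p i)) ∘ₗ
        (⋀[ℝ]^k V).subtype ∘ₗ exteriorPower.map k (N.fibre p).subtype))
    (fun η => Submodule.smul_mem _ _ (SetLike.mul_mem_graded
      (ExteriorAlgebra.ιMulti_range ℝ n ⟨_, rfl⟩)
      (exteriorPower.map k (N.fibre p).subtype η).2))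

/-- The fibre `B_p = {η ∈ ⋀ᵏ N_p | ν̃_N(η) ∈ S}` of the transversal ellipsoid bundle. -/
def ellipsoidFibre (N : TransversalBundle n f k) (E : EquiaffineStructure n M)
    {Ω : V [⋀^Fin (n + k + 1)]→ₗ[ℝ] ℝ} (S : UnitEllipsoid Ω) (p : M) :
    Set (⋀[ℝ]^k (N.fibre p)) :=
  {η | N.gauss E p η ∈ S.carrier}

/-- The Lipschitz–Killing curvature `G(η) = (-1)ⁿ det [h̃_η(α(eᵢ, eⱼ))]`, where `h̃_η` is the height
function of `ν̃_N(η)` and `θ(e₁, …, eₙ) = 1`; for an arbitrary frame `e` the determinant has to be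
divided by `θ(e)²`. -/
def lipschitzKilling (N : TransversalBundle n f k) (E : EquiaffineStructure n M)
    (Ω : V [⋀^Fin (n + k + 1)]→ₗ[ℝ] ℝ) (p : M) (η : ⋀[ℝ]^k (N.fibre p)) : ℝ :=
  (-1) ^ n *
    (Matrix.of fun i j =>
      height Ω (N.gauss E p η) (N.fundamentalForm p (E.frame p i) (E.frame p j))).det /
    E.vol p (E.frame p) ^ 2

/-- Linear coordinates on `⋀ᵏ N_p` in which the volume element of `⋀ᵏ N_p` induced by `θ^⊥` is `±`
the determinant: `a ↦ ∑ aᵢ ξ₀ ∧ ⋯ ∧ ξ̂ᵢ ∧ ⋯ ∧ ξ_k` for a frame `ξ` with `θ^⊥(ξ) = 1`. -/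
def coord (N : TransversalBundle n f k) (p : M) (a : Fin (k + 1) → ℝ) :
    ⋀[ℝ]^k (N.fibre p) :=
  ∑ i, a i • omitWedge (unimodularFrame (N.vol p)) i

/-- The measure on the ellipsoid `{a ∈ ℝᵈ | Q a = 1}` (`Q` a positive definite quadratic form) of
its volume element `(X₁, …, X_{d-1}) ↦ det(a, X₁, …, X_{d-1})`, as a measure on `ℝᵈ`: the measure of
`A` is `d` times the Lebesgue measure of the cone `{t a | 0 < t < 1, a ∈ A, Q a = 1}`. -/
def _root_.EquiaffineGeometry.ellipsoidMeasure {d : ℕ} (Q : (Fin d → ℝ) → ℝ) :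
    MeasureTheory.Measure (Fin d → ℝ) :=
  ((d : ℝ≥0∞) • MeasureTheory.volume.restrict {a | 0 < Q a ∧ Q a < 1}).map
    fun a => (√(Q a))⁻¹ • a

/-- The measure of the fibre `B_p` (in the coordinates `coord`), given by the volume element of
`⋀ᵏ N_p` contracted with the position vector. -/
def fibreMeasure (N : TransversalBundle n f k) (E : EquiaffineStructure n M)
    {Ω : V [⋀^Fin (n + k + 1)]→ₗ[ℝ] ℝ} (S : UnitEllipsoid Ω) (p : M) :
    MeasureTheory.Measure (Fin (k + 1) → ℝ) :=
  ellipsoidMeasure fun a => S.sq (N.gauss E p (N.coord p a))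

/-- The total absolute curvature `τ_S(f) = vol(𝕊^{n+k})⁻¹ ∫_B |G| ω_B`. The volume element of the
transversal ellipsoid bundle `π : B → M` is `ω_B = π^*θ ∧ Ω_{B_p}`, so that the integral over `B` is
the integral over `M` of the integrals over the fibres `B_p`. -/
def totalAbsoluteCurvature [MeasurableSpace M] (N : TransversalBundle n f k)
    (E : EquiaffineStructure n M) {Ω : V [⋀^Fin (n + k + 1)]→ₗ[ℝ] ℝ} (S : UnitEllipsoid Ω) : ℝ≥0∞ :=
  (∫⁻ p, ∫⁻ a, ‖N.lipschitzKilling E Ω p (N.coord p a)‖ₑ ∂N.fibreMeasure E S p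
      ∂volumeMeasure E.vol) /
    (MeasureTheory.volume : MeasureTheory.Measure
      (EuclideanSpace ℝ (Fin (n + k + 1)))).toSphere Set.univ

end TransversalBundle

end Manifold

end EquiaffineGeometry

end

open EquiaffineGeometry

/-!
Write `l` for linear functionals on `V = ℝⁿ⁺ᵏ⁺¹`. A conormal functional at `p` is an `l` that
vanishes on `df(T_pM)`; the pairs `(p, l)` form a bundle over `M` of total dimension `n + k + 1`,
and its Gauss map is `(p, l) ↦ l ∈ V*`. The map `η ↦ height of ν̃_N(η)` identifies `⋀ᵏ N_p` with the
conormal functionals at `p`, and a unit ellipsoid `S` becomes the Euclidean unit sphere of `V*` in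
the coordinates `l ↦ (l (w i))ᵢ` of a suitable unimodular frame `w` (`UnitEllipsoid.exists_sq_eq`).
The Lipschitz–Killing curvature at `η` is then, up to sign and the volume of the frame, the Hessian
determinant of `l ∘ f`, which is also the Jacobian of the Gauss map (`abs_det_fderiv_conormalMap`).

Since `G` is homogeneous of degree `n` on each fibre, the integral over an ellipsoid can be replaced
by `n + k + 1` times the integral over the solid ellipsoid (`lintegral_ellipsoidMeasure`). So the
total absolute curvature is `vol(𝔹)⁻¹` times the integral of the absolute Jacobian of the Gauss map
over the part of the conormal bundle that lies over the unit ball `𝔹` of `V*`; only a lower bound is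
needed (`TransversalBundle.fibreIntegral_chart`, `AdaptedChart.lintegral_det_le`).

On the compact manifold `M` each `l ∘ f` has a maximum and a minimum, and `l` is conormal there. By
the area inequality the points `(p, l)` with `l ∘ f` maximal at `p` contribute at least `vol(𝔹)` to
the integral, and so do those with `l ∘ f` minimal but not maximal, because for a non-constant `f`
the `l` with `l ∘ f` constant form a null set. If at some `(p, l)` the Hessian of `l ∘ f` is
non-degenerate and `l ∘ f` is neither maximal nor minimal, the same holds on an open set and the
total absolute curvature exceeds `2` (`lt_lintegral_fibreIntegral`).

Let the curvature be `2`. It is not zero, so a non-degenerate `(p, l₀)` exists. For every conormal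
`l` at `p` the functional `l + t l₀` is non-degenerate for all small `t ≠ 0`, hence `l ∘ f` is
extremal at `p` for all conormal `l` at `p` (`exists_forall_not_lt_and_lt`). If the vectors `f q - f
p` spanned two dimensions modulo `df(T_pM)`, some conormal `l` would take values of both signs on
them; so they span at most one (`exists_affineSubspace`).
-/

noncomputable section

set_option linter.unusedSectionVars false

namespace EquiaffineGeometry

/-! ### Volume elements and the Gauss map -/

section LinearAlgebra

variable {V : Type*} [AddCommGroup V] [Module ℝ V] {m : ℕ}

theorem map_sum_smul {d : ℕ} (Ω : V [⋀^Fin d]→ₗ[ℝ] ℝ) (v : Fin d → V)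
    (A : Matrix (Fin d) (Fin d) ℝ) : Ω (fun i => ∑ j, A i j • v j) = A.det * Ω v := by
  have h := (Ω.compLinearMap (Fintype.linearCombination ℝ v)).eq_smul_basis_det
    (Pi.basisFun ℝ (Fin d))
  have h2 := congrArg (fun φ => φ A) h
  simp only [AlternatingMap.compLinearMap_apply, Pi.basisFun_det] at h2
  have h3 : (Ω fun i => Fintype.linearCombination ℝ v (Pi.basisFun ℝ (Fin d) i)) = Ω v := by
    congr 1
    funext i
    simp [Fintype.linearCombination_apply_single]
  rw [h3] at h2
  rw [mul_comm]
  exact h2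

theorem map_unimodularFrame {d : ℕ} {Ω : V [⋀^Fin (d + 1)]→ₗ[ℝ] ℝ} (hΩ : Ω ≠ 0) :
    Ω (unimodularFrame Ω) = 1 := by
  refine Classical.epsilon_spec (p := fun v => Ω v = 1) ?_
  obtain ⟨v, hv⟩ : ∃ v, Ω v ≠ 0 := by
    by_contra! h
    exact hΩ (AlternatingMap.ext h)
  refine ⟨Function.update v 0 ((Ω v)⁻¹ • v 0), ?_⟩
  rw [Ω.map_update_smul, Function.update_eq_self, smul_eq_mul, inv_mul_cancel₀ hv]

/-- In the coordinates of `V*` given by a suitable unimodular frame `w` of `V`, the ellipsoid `S`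
is the Euclidean unit sphere. -/
theorem UnitEllipsoid.exists_sq_eq {Ω : V [⋀^Fin (m + 1)]→ₗ[ℝ] ℝ} (hΩ : Ω ≠ 0)
    (S : UnitEllipsoid Ω) :
    ∃ w : Fin (m + 1) → V, Ω w = 1 ∧ ∀ φ, S.sq φ = ∑ l, height Ω φ (w l) ^ 2 := by
  set v := unimodularFrame Ω with hv
  have hv1 : Ω v = 1 := map_unimodularFrame hΩ
  set A : Matrix (Fin (m + 1)) (Fin (m + 1)) ℝ := Matrix.of fun i j => height Ω (S.basis i) (v j)
    with hA
  have hA1 : A.det = 1 := S.dualVolume_basis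
  have hunit : IsUnit A.det := by simp [hA1]
  have hw (i l) : height Ω (S.basis i) (∑ j, A⁻¹.transpose l j • v j) = if i = l then 1 else 0 := by
    have h := congrFun (congrFun (Matrix.mul_nonsing_inv A hunit) i) l
    rw [Matrix.one_apply, Matrix.mul_apply] at h
    rw [← h]
    simp [hA, mul_comm]
  refine ⟨fun l => ∑ j, A⁻¹.transpose l j • v j, ?_, fun φ => ?_⟩
  · rw [map_sum_smul, Matrix.det_transpose, Matrix.det_nonsing_inv, hA1, hv1]
    simp
  · rw [UnitEllipsoid.sq]
    refine Finset.sum_congr rfl fun l _ => ?_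
    conv_rhs => rw [← S.basis.sum_repr φ]
    simp_rw [map_sum (height Ω), LinearMap.sum_apply, map_smul (height Ω), LinearMap.smul_apply,
      hw]
    simp

theorem append_snoc {α : Type*} {a b : ℕ} (x : Fin a → α) (y : Fin b → α) (z : α) :
    (Fin.snoc (Fin.append x y) z : Fin (a + b + 1) → α) =
      Fin.append (n := b + 1) x (Fin.snoc y z) := by
  funext i
  refine Fin.addCases (m := a) (n := b + 1) (fun i => ?_) (fun j => ?_) i
  · have h : (Fin.castAdd (b + 1) i : Fin (a + b + 1)) = Fin.castSucc (Fin.castAdd b i) := rfl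
    rw [Fin.append_left]
    conv_lhs => rw [h]
    simp [Fin.snoc_castSucc]
  · rw [Fin.append_right]
    refine Fin.lastCases ?_ (fun j => ?_) j
    · have h : (Fin.natAdd a (Fin.last b) : Fin (a + b + 1)) = Fin.last (a + b) := rfl
      conv_lhs => rw [h]
      simp
    · have h : (Fin.natAdd a (Fin.castSucc j) : Fin (a + b + 1)) = Fin.castSucc (Fin.natAdd a j) :=
        rfl
      conv_lhs => rw [h]
      rw [Fin.snoc_castSucc, Fin.append_right, Fin.snoc_castSucc]

theorem ιMulti_mul_ιMulti {a b : ℕ} (x : Fin a → V) (y : Fin b → V) :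
    ExteriorAlgebra.ιMulti ℝ a x * ExteriorAlgebra.ιMulti ℝ b y =
      ExteriorAlgebra.ιMulti ℝ (a + b) (Fin.append x y) := by
  simp only [ExteriorAlgebra.ιMulti_apply]
  rw [← List.prod_append, ← List.ofFn_fin_append]
  congr 2
  funext i
  refine Fin.addCases (fun i => ?_) (fun j => ?_) i <;> simp

theorem linearIndependent_of_map_ne_zero {d : ℕ} (Ω : V [⋀^Fin d]→ₗ[ℝ] ℝ) {v : Fin d → V}
    (h : Ω v ≠ 0) : LinearIndependent ℝ v := by
  by_contra hv
  exact h (Ω.map_linearDependent v hv)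

theorem map_ne_zero_of_linearIndependent [FiniteDimensional ℝ V] {d : ℕ}
    (hV : Module.finrank ℝ V = d) {Ω : V [⋀^Fin d]→ₗ[ℝ] ℝ} (hΩ : Ω ≠ 0) {v : Fin d → V}
    (hv : LinearIndependent ℝ v) : Ω v ≠ 0 := by
  intro h
  have hb := Ω.eq_smul_basis_det
    (Module.Basis.mk hv (hv.span_eq_top_of_card_eq_finrank' (by simp [hV])).ge)
  rw [Module.Basis.coe_mk, h, zero_smul] at hb
  exact hΩ hb

end LinearAlgebra

section Gauss

variable {n : ℕ} {M : Type*} [TopologicalSpace M] [ChartedSpace (EuclideanSpace ℝ (Fin n)) M]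
  [IsManifold (𝓡 n) ∞ M] {V : Type*} [NormedAddCommGroup V] [NormedSpace ℝ V] {k : ℕ} {f : M → V}

instance (p : M) : FiniteDimensional ℝ (TangentSpace (𝓡 n) p) :=
  inferInstanceAs (FiniteDimensional ℝ (EuclideanSpace ℝ (Fin n)))

theorem finrank_tangentSpace (p : M) : Module.finrank ℝ (TangentSpace (𝓡 n) p) = n :=
  finrank_euclideanSpace_fin (𝕜 := ℝ) (n := n)

theorem EquiaffineStructure.vol_frame_ne_zero (E : EquiaffineStructure n M) (p : M) :
    E.vol p (E.frame p) ≠ 0 := by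
  refine Classical.epsilon_spec (p := fun e => E.vol p e ≠ 0) ?_
  by_contra! h
  exact E.vol_ne_zero p (AlternatingMap.ext h)

namespace TransversalBundle

theorem finrank_fibre (N : TransversalBundle n f k) (p : M) :
    Module.finrank ℝ (N.fibre p) = k + 1 := by
  obtain ⟨U, -, hpU, ζ, -, hζ⟩ := N.exists_frame p
  obtain ⟨h1, h2⟩ := hζ p hpU
  rw [← h2, finrank_span_eq_card h1, Fintype.card_fin]

instance (N : TransversalBundle n f k) (p : M) : FiniteDimensional ℝ (N.fibre p) :=
  Module.finite_of_finrank_pos (by rw [N.finrank_fibre p]; omega)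

/-- The relation between the volume elements of `M`, of `N` and of `V`. It also holds when `ξ` is
linearly dependent, both sides being zero then. -/
theorem append_eq_mul {N : TransversalBundle n f k} {Ω : V [⋀^Fin (n + k + 1)]→ₗ[ℝ] ℝ}
    {E : EquiaffineStructure n M} (hN : N.Induces Ω E) (p : M)
    (X : Fin n → TangentSpace (𝓡 n) p) (ξ : Fin (k + 1) → N.fibre p) :
    Ω (Fin.append (n := k + 1) (fun i => df n f p (X i)) fun j => (ξ j : V)) =
      E.vol p X * N.vol p ξ := by
  by_cases h : N.vol p ξ = 0
  · have hξ : ¬ LinearIndependent ℝ ξ := fun hli =>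
      map_ne_zero_of_linearIndependent (N.finrank_fibre p) (N.vol_ne_zero p) hli h
    rw [h, mul_zero]
    refine Ω.map_linearDependent _ fun hli => hξ ?_
    have h2 := hli.comp (Fin.natAdd n : Fin (k + 1) → Fin (n + (k + 1))) (Fin.natAdd_injective _ _)
    have h3 : (Fin.append (n := k + 1) (fun i => df n f p (X i)) fun j => (ξ j : V)) ∘
        (Fin.natAdd n : Fin (k + 1) → Fin (n + (k + 1))) = (N.fibre p).subtype ∘ ξ := by
      funext j
      simp [Fin.append_right]
    rw [h3] at h2
    exact h2.of_comp _
  · rw [hN.vol p X ξ h]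
    field_simp

theorem vol_unimodularFrame (N : TransversalBundle n f k) (p : M) :
    N.vol p (unimodularFrame (N.vol p)) = 1 :=
  map_unimodularFrame (N.vol_ne_zero p)

theorem gauss_ιMulti (N : TransversalBundle n f k) (E : EquiaffineStructure n M) (p : M)
    (ξ : Fin k → N.fibre p) :
    N.gauss E p (exteriorPower.ιMulti ℝ k ξ) = (E.vol p (E.frame p))⁻¹ •
      exteriorPower.ιMulti ℝ (n + k)
        (Fin.append (fun i => df n f p (E.frame p i)) fun j => (ξ j : V)) := by
  apply Subtype.ext
  simp only [gauss, LinearMap.codRestrict_apply, LinearMap.smul_apply, LinearMap.comp_apply,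
    LinearMap.mulLeft_apply, Submodule.subtype_apply, exteriorPower.map_apply_ιMulti,
    Submodule.coe_smul, exteriorPower.ιMulti_apply_coe]
  rw [ιMulti_mul_ιMulti]
  rfl

theorem height_gauss_ιMulti_df (N : TransversalBundle n f k) (E : EquiaffineStructure n M)
    (Ω : V [⋀^Fin (n + k + 1)]→ₗ[ℝ] ℝ) (p : M) (ξ : Fin k → N.fibre p)
    (x : TangentSpace (𝓡 n) p) :
    height Ω (N.gauss E p (exteriorPower.ιMulti ℝ k ξ)) (df n f p x) = 0 := by
  have hli := linearIndependent_of_map_ne_zero (E.vol p) (E.vol_frame_ne_zero p)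
  have hspan : x ∈ Submodule.span ℝ (Set.range (E.frame p)) := by
    rw [hli.span_eq_top_of_card_eq_finrank' (by simp [finrank_tangentSpace])]
    trivial
  rw [gauss_ιMulti, map_smul, LinearMap.smul_apply]
  refine smul_eq_zero_of_right _ ?_
  induction hspan using Submodule.span_induction with
  | mem x hx =>
    obtain ⟨i, rfl⟩ := hx
    rw [height_cons, Ω.map_eq_zero_of_eq (i := 0) (j := (Fin.castAdd k i).succ) _ (by simp)
      (Fin.succ_ne_zero _).symm, mul_zero]
  | zero => simp
  | add a b _ _ ha hb => simp [ha, hb]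
  | smul c a _ ha => simp [ha]

/-- On `N`, the height function of `ν̃_N(η)` is the height function of `η` with respect to `θ^⊥`. -/
theorem height_gauss_ιMulti {N : TransversalBundle n f k} {E : EquiaffineStructure n M}
    {Ω : V [⋀^Fin (n + k + 1)]→ₗ[ℝ] ℝ} (hN : N.Induces Ω E) (p : M) (ξ : Fin k → N.fibre p)
    (v : N.fibre p) :
    height Ω (N.gauss E p (exteriorPower.ιMulti ℝ k ξ)) v =
      height (N.vol p) (exteriorPower.ιMulti ℝ k ξ) v := by
  rw [gauss_ιMulti, map_smul, LinearMap.smul_apply, height_ιMulti, height_ιMulti, append_snoc]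
  have h : (Fin.snoc (fun j => (ξ j : V)) (v : V) : Fin (k + 1) → V) =
      fun j => ((Fin.snoc ξ v : Fin (k + 1) → N.fibre p) j : V) := by
    funext j
    refine Fin.lastCases ?_ (fun j => ?_) j <;> simp
  rw [h, append_eq_mul hN, smul_eq_mul, inv_mul_cancel_left₀ (E.vol_frame_ne_zero p)]

theorem height_gauss_coord_df (N : TransversalBundle n f k) (E : EquiaffineStructure n M)
    (Ω : V [⋀^Fin (n + k + 1)]→ₗ[ℝ] ℝ) (p : M) (a : Fin (k + 1) → ℝ)
    (x : TangentSpace (𝓡 n) p) :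
    height Ω (N.gauss E p (N.coord p a)) (df n f p x) = 0 := by
  simp [coord, omitWedge, map_sum, LinearMap.sum_apply, height_gauss_ιMulti_df]

theorem height_gauss_coord_frame {N : TransversalBundle n f k} {E : EquiaffineStructure n M}
    {Ω : V [⋀^Fin (n + k + 1)]→ₗ[ℝ] ℝ} (hN : N.Induces Ω E) (p : M) (a : Fin (k + 1) → ℝ)
    (j : Fin (k + 1)) :
    height Ω (N.gauss E p (N.coord p a)) (unimodularFrame (N.vol p) j : N.fibre p) =
      (-1) ^ (k - (j : ℕ)) * a j := by
  have h (i : Fin (k + 1)) : height Ω (N.gauss E p (omitWedge (unimodularFrame (N.vol p)) i))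
      (unimodularFrame (N.vol p) j : N.fibre p) = if i = j then (-1) ^ (k - (i : ℕ)) else 0 := by
    rw [omitWedge, height_gauss_ιMulti hN]
    have := height_omitWedge (N.vol p) (unimodularFrame (N.vol p)) i j
    rwa [vol_unimodularFrame, mul_one] at this
  simp [coord, map_sum, LinearMap.sum_apply, h, mul_comm]

end TransversalBundle

end Gauss

/-! ### Integration in polar coordinates -/

section Polar

open MeasureTheory

theorem lintegral_Ioo_deriv {φ φ' : ℝ → ℝ} {a b : ℝ} (hab : a ≤ b)
    (h : ∀ t ∈ Set.Icc a b, HasDerivAt φ (φ' t) t) (hc : ContinuousOn φ' (Set.Icc a b))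
    (h0 : ∀ t ∈ Set.Icc a b, 0 ≤ φ' t) :
    ∫⁻ t in Set.Ioo a b, ENNReal.ofReal (φ' t) = ENNReal.ofReal (φ b - φ a) := by
  have hi : IntervalIntegrable φ' volume a b :=
    ContinuousOn.intervalIntegrable (by rwa [Set.uIcc_of_le hab])
  rw [← intervalIntegral.integral_eq_sub_of_hasDerivAt
    (fun t ht => h t (by rwa [Set.uIcc_of_le hab] at ht)) hi,
    intervalIntegral.integral_of_le hab, ← restrict_Ioo_eq_restrict_Ioc,
    ofReal_integral_eq_lintegral_ofReal]
  · have := (intervalIntegrable_iff_integrableOn_Ioc_of_le hab).1 hi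
    exact this.mono_set Set.Ioo_subset_Ioc_self
  · filter_upwards [ae_restrict_mem measurableSet_Ioo] with t ht
    exact h0 t (Set.Ioo_subset_Icc_self ht)

/-- The weight `r⁻ⁿ` as an integral over the levels `t > r`, which turns a weighted integral over a
solid ellipsoid into a superposition of integrals over smaller ones. -/
theorem ofReal_inv_pow_eq (n : ℕ) {r : ℝ} (hr : 0 < r) (hr1 : r < 1) :
    ENNReal.ofReal ((r ^ n)⁻¹) =
      1 + ∫⁻ t in Set.Ioo r 1, ENNReal.ofReal (n * (t ^ (n + 1))⁻¹) := by
  have hpos {t : ℝ} (ht : t ∈ Set.Icc r 1) : 0 < t := hr.trans_le ht.1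
  rw [lintegral_Ioo_deriv (φ := fun t => -(t ^ (-n : ℤ))) hr1.le]
  · rw [← ENNReal.ofReal_one, ← ENNReal.ofReal_add zero_le_one]
    · simp
    · have : (1 : ℝ) ≤ (r ^ n)⁻¹ := (one_le_inv₀ (by positivity)).2 (pow_le_one₀ hr.le hr1.le)
      simpa using this
  · intro t ht
    have h := (hasDerivAt_zpow (-n : ℤ) t (Or.inl (hpos ht).ne')).neg
    have h2 : (-(n : ℤ) - 1) = -((n + 1 : ℕ) : ℤ) := by push_cast; ring
    rw [h2, zpow_neg t, zpow_natCast] at h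
    refine h.congr_deriv ?_
    push_cast
    ring
  · refine continuousOn_const.mul (ContinuousOn.inv₀ (by fun_prop) fun t ht => ?_)
    exact (pow_pos (hpos ht) _).ne'
  · intro t ht
    have := hpos ht
    positivity

theorem lintegral_comp_smul {d : ℕ} (g : (Fin d → ℝ) → ℝ≥0∞) (hg : Measurable g) {t : ℝ}
    (ht : 0 < t) : ∫⁻ a, g a = ENNReal.ofReal (t ^ d) * ∫⁻ a, g (t • a) := by
  have h := Measure.map_addHaar_smul (volume : Measure (Fin d → ℝ)) ht.ne'
  have h2 : ∫⁻ a, g (t • a) = ∫⁻ a, g a ∂(Measure.map (t • ·) (volume : Measure (Fin d → ℝ))) :=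
    (lintegral_map hg (measurable_const_smul t)).symm
  rw [h2, h, lintegral_smul_measure, smul_eq_mul, ← mul_assoc, ← ENNReal.ofReal_mul (by positivity)]
  rw [Module.finrank_fin_fun, abs_of_pos (by positivity), mul_inv_cancel₀ (by positivity)]
  simp

/-- Integration in polar coordinates: for a function `g` that is homogeneous of degree `n`, the
integral over the ellipsoid `Q = 1` is, up to the factor `n + k + 1`, the integral over the solid
ellipsoid. -/
theorem lintegral_ellipsoidMeasure (n : ℕ) {k : ℕ} {Q : (Fin (k + 1) → ℝ) → ℝ}
    (hQc : Continuous Q) (hQ : ∀ (t : ℝ) a, Q (t • a) = t ^ 2 * Q a)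
    {g : (Fin (k + 1) → ℝ) → ℝ≥0∞} (hg : Measurable g)
    (hgh : ∀ t : ℝ, 0 < t → ∀ a, g (t • a) = ENNReal.ofReal (t ^ n) * g a) :
    ∫⁻ a, g a ∂ellipsoidMeasure Q =
      ((n + k + 1 : ℕ) : ℝ≥0∞) * ∫⁻ a in {a | 0 < Q a ∧ Q a < 1}, g a := by
  have hsq : Measurable fun a => √(Q a) := (hQc.sqrt).measurable
  set D : Set (Fin (k + 1) → ℝ) := {a | 0 < Q a ∧ Q a < 1} with hD
  have hDm : MeasurableSet D :=
    (measurableSet_lt measurable_const hQc.measurable).inter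
      (measurableSet_lt hQc.measurable measurable_const)
  have hsc : Measurable fun a : Fin (k + 1) → ℝ => (√(Q a))⁻¹ • a := by fun_prop
  -- the integral over the smaller ellipsoids
  have hΦ (t : ℝ) (ht : 0 < t) (ht1 : t < 1) :
      ∫⁻ a in D, (if √(Q a) < t then g a else 0) =
        ENNReal.ofReal (t ^ (n + k + 1)) * ∫⁻ a in D, g a := by
    rw [← lintegral_indicator hDm, ← lintegral_indicator hDm, lintegral_comp_smul _ _ ht,
      show n + k + 1 = k + 1 + n by ring, pow_add _ (k + 1), ENNReal.ofReal_mul (by positivity),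
      mul_assoc]
    · congr 1
      rw [← lintegral_const_mul _ (hg.indicator hDm)]
      refine lintegral_congr fun a => ?_
      have h1 : √(Q (t • a)) = t * √(Q a) := by
        rw [hQ, Real.sqrt_mul (by positivity), Real.sqrt_sq ht.le]
      have h2 : (t • a ∈ D ∧ √(Q (t • a)) < t) ↔ a ∈ D := by
        rw [h1]
        simp only [hD, Set.mem_ofPred_eq, hQ]
        constructor
        · rintro ⟨⟨h3, -⟩, h4⟩
          have h5 : 0 < Q a := by
            by_contra! h
            have := mul_nonpos_of_nonneg_of_nonpos (sq_nonneg t) h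
            linarith
          refine ⟨h5, ?_⟩
          have : √(Q a) < 1 := by
            by_contra! h
            nlinarith
          rw [Real.sqrt_lt' one_pos] at this
          simpa using this
        · rintro ⟨h3, h4⟩
          refine ⟨⟨by positivity, ?_⟩, ?_⟩
          · have : t ^ 2 < 1 := by nlinarith
            nlinarith
          · have : √(Q a) < 1 := by rw [Real.sqrt_lt' one_pos]; simpa using h4
            nlinarith
      by_cases ha : a ∈ D
      · obtain ⟨h3, h4⟩ := h2.2 ha
        simp [Set.indicator_of_mem ha, Set.indicator_of_mem h3, h4, hgh t ht]
      · rw [Set.indicator_of_notMem ha, mul_zero]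
        by_cases h3 : t • a ∈ D
        · have h4 : ¬ √(Q (t • a)) < t := fun h4 => ha (h2.1 ⟨h3, h4⟩)
          simp [Set.indicator_of_mem h3, h4]
        · rw [Set.indicator_of_notMem h3]
    · exact (Measurable.ite (measurableSet_lt hsq measurable_const) hg
        measurable_const).indicator hDm
  rw [ellipsoidMeasure, lintegral_map hg hsc, lintegral_smul_measure]
  have h1 : ∫⁻ a in D, g ((√(Q a))⁻¹ • a) = ∫⁻ a in D, (g a +
      ∫⁻ t in Set.Ioo (0 : ℝ) 1, ENNReal.ofReal (n * (t ^ (n + 1))⁻¹) *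
        (if √(Q a) < t then g a else 0)) := by
    refine setLIntegral_congr_fun hDm fun a ha => ?_
    have hr : 0 < √(Q a) := Real.sqrt_pos.2 ha.1
    have hr1 : √(Q a) < 1 := by rw [Real.sqrt_lt' one_pos]; simpa using ha.2
    have h2 : ∫⁻ t in Set.Ioo (0 : ℝ) 1, ENNReal.ofReal (n * (t ^ (n + 1))⁻¹) *
        (if √(Q a) < t then g a else 0) =
          (∫⁻ t in Set.Ioo (√(Q a)) 1, ENNReal.ofReal (n * (t ^ (n + 1))⁻¹)) * g a := by
      rw [← lintegral_mul_const _ (by fun_prop), ← lintegral_indicator measurableSet_Ioo,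
        ← lintegral_indicator measurableSet_Ioo]
      refine lintegral_congr fun t => ?_
      simp only [Set.indicator_apply, Set.mem_Ioo]
      by_cases h3 : √(Q a) < t
      · simp [h3, hr.trans h3]
      · simp [h3]
    rw [h2, hgh _ (inv_pos.2 hr), inv_pow, ofReal_inv_pow_eq n hr hr1, add_mul, one_mul]
  have hjoint : Measurable fun z : (Fin (k + 1) → ℝ) × ℝ =>
      ENNReal.ofReal (n * (z.2 ^ (n + 1))⁻¹) * (if √(Q z.1) < z.2 then g z.1 else 0) := by
    refine Measurable.mul (by fun_prop)
      (Measurable.ite ?_ (hg.comp measurable_fst) measurable_const)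
    exact measurableSet_lt (hsq.comp measurable_fst) measurable_snd
  have h2 : ∫⁻ a in D, ∫⁻ t in Set.Ioo (0 : ℝ) 1, ENNReal.ofReal (n * (t ^ (n + 1))⁻¹) *
        (if √(Q a) < t then g a else 0) =
      ENNReal.ofReal (n / (k + 1)) * ∫⁻ a in D, g a := by
    rw [lintegral_lintegral_swap hjoint.aemeasurable]
    have h3 : ∀ t ∈ Set.Ioo (0 : ℝ) 1, ∫⁻ a in D, ENNReal.ofReal (n * (t ^ (n + 1))⁻¹) *
        (if √(Q a) < t then g a else 0) =
          ENNReal.ofReal (n * t ^ k) * ∫⁻ a in D, g a := by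
      intro t ht
      rw [lintegral_const_mul _ (Measurable.ite (measurableSet_lt hsq measurable_const) hg
        measurable_const), hΦ t ht.1 ht.2, ← mul_assoc, ← ENNReal.ofReal_mul (by
          have := ht.1; positivity)]
      congr 2
      have := ht.1.ne'
      field_simp
      ring
    rw [setLIntegral_congr_fun measurableSet_Ioo h3, lintegral_mul_const _ (by fun_prop)]
    congr 1
    rw [lintegral_Ioo_deriv (φ := fun t => n / (k + 1) * t ^ (k + 1)) zero_le_one]
    · simp
    · intro t _
      have h4 := (hasDerivAt_pow (k + 1) t).const_mul ((n : ℝ) / (k + 1))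
      refine h4.congr_deriv ?_
      push_cast
      field_simp
    · fun_prop
    · intro t ht
      have := ht.1
      positivity
  rw [h1, lintegral_add_left hg, h2, smul_eq_mul, ← one_add_mul, ← mul_assoc]
  congr 1
  rw [← ENNReal.ofReal_one, ← ENNReal.ofReal_add zero_le_one (by positivity),
    ← ENNReal.ofReal_natCast, ← ENNReal.ofReal_mul (by positivity), ← ENNReal.ofReal_natCast]
  congr 1
  push_cast
  field_simp
  ring

end Polar

/-! ### The integral over a fibre -/

section Fibre

open MeasureTheory

theorem lintegral_comp_linearMap {d : ℕ} (T : (Fin d → ℝ) →ₗ[ℝ] (Fin d → ℝ))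
    (hT : LinearMap.det T ≠ 0) {h : (Fin d → ℝ) → ℝ≥0∞} (hh : Measurable h) :
    ∫⁻ a, h (T a) = ‖(LinearMap.det T)⁻¹‖ₑ * ∫⁻ b, h b := by
  have h1 := Measure.map_linearMap_addHaar_eq_smul_addHaar (volume : Measure (Fin d → ℝ)) hT
  rw [← lintegral_map hh T.continuous_of_finiteDimensional.measurable, h1, lintegral_smul_measure,
    smul_eq_mul, Real.enorm_eq_ofReal_abs]

variable {n : ℕ} {M : Type*} [TopologicalSpace M] [ChartedSpace (EuclideanSpace ℝ (Fin n)) M]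
  [IsManifold (𝓡 n) ∞ M] {V : Type*} [NormedAddCommGroup V] [NormedSpace ℝ V] {k : ℕ} {f : M → V}

namespace TransversalBundle

/-- The integral of `|G|` over the fibre `B_p`. -/
def fibreIntegral (N : TransversalBundle n f k) (E : EquiaffineStructure n M)
    {Ω : V [⋀^Fin (n + k + 1)]→ₗ[ℝ] ℝ} (S : UnitEllipsoid Ω) (p : M) : ℝ≥0∞ :=
  ∫⁻ a, ‖N.lipschitzKilling E Ω p (N.coord p a)‖ₑ ∂N.fibreMeasure E S p

/-- A frame of `N_p` as a basis. -/
def basisOfVol (N : TransversalBundle n f k) (p : M) {ξ : Fin (k + 1) → N.fibre p}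
    (hξ : N.vol p ξ ≠ 0) : Module.Basis (Fin (k + 1)) ℝ (N.fibre p) :=
  basisOfLinearIndependentOfCardEqFinrank (linearIndependent_of_map_ne_zero _ hξ)
    (by simp [finrank_fibre])

theorem coe_basisOfVol (N : TransversalBundle n f k) (p : M) {ξ : Fin (k + 1) → N.fibre p}
    (hξ : N.vol p ξ ≠ 0) : ⇑(N.basisOfVol p hξ) = ξ :=
  coe_basisOfLinearIndependentOfCardEqFinrank _ _

/-- A conormal functional at `p` is determined by its values on a frame of `N_p`. -/
theorem conormal_ext (N : TransversalBundle n f k) (p : M) {ξ : Fin (k + 1) → N.fibre p}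
    (hξ : N.vol p ξ ≠ 0) {l₁ l₂ : V →ₗ[ℝ] ℝ} (h₁ : ∀ x, l₁ (df n f p x) = 0)
    (h₂ : ∀ x, l₂ (df n f p x) = 0) (h : ∀ j, l₁ (ξ j) = l₂ (ξ j)) : l₁ = l₂ := by
  have hN : l₁ ∘ₗ (N.fibre p).subtype = l₂ ∘ₗ (N.fibre p).subtype := by
    refine (N.basisOfVol p hξ).ext fun j => ?_
    simpa [coe_basisOfVol] using h j
  ext v
  have hv : v ∈ LinearMap.range (df n f p) ⊔ N.fibre p := by
    rw [(N.isCompl p).sup_eq_top]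
    trivial
  obtain ⟨_, ⟨x, rfl⟩, z, hz, rfl⟩ := Submodule.mem_sup.1 hv
  have := LinearMap.congr_fun hN ⟨z, hz⟩
  simp only [LinearMap.comp_apply, Submodule.subtype_apply] at this
  rw [map_add, map_add, h₁, h₂, this]

/-- The conormal functional `h̃` of `ν̃_N(η)` for the point `η` of `⋀ᵏ N_p` with coordinates `a`. -/
def coordHeight (N : TransversalBundle n f k) (E : EquiaffineStructure n M)
    (Ω : V [⋀^Fin (n + k + 1)]→ₗ[ℝ] ℝ) (p : M) : (Fin (k + 1) → ℝ) →ₗ[ℝ] V →ₗ[ℝ] ℝ :=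
  height Ω ∘ₗ N.gauss E p ∘ₗ Fintype.linearCombination ℝ (omitWedge (unimodularFrame (N.vol p)))

theorem coordHeight_apply (N : TransversalBundle n f k) (E : EquiaffineStructure n M)
    (Ω : V [⋀^Fin (n + k + 1)]→ₗ[ℝ] ℝ) (p : M) (a : Fin (k + 1) → ℝ) :
    N.coordHeight E Ω p a = height Ω (N.gauss E p (N.coord p a)) := rfl

/-- The curvature in an arbitrary frame `e`. The fundamental form may be replaced by any bilinear
map `B` with the same values under conormal functionals, such as the second derivative of `f` in a
chart. -/
theorem lipschitzKilling_coord (N : TransversalBundle n f k) (E : EquiaffineStructure n M)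
    (Ω : V [⋀^Fin (n + k + 1)]→ₗ[ℝ] ℝ) (p : M) {e : Fin n → TangentSpace (𝓡 n) p}
    (he : E.vol p e ≠ 0) (B : TangentSpace (𝓡 n) p →ₗ[ℝ] TangentSpace (𝓡 n) p →ₗ[ℝ] V)
    (hB : ∀ l : V →ₗ[ℝ] ℝ, (∀ x, l (df n f p x) = 0) →
      ∀ x y, l (N.fundamentalForm p x y) = l (B x y)) (a : Fin (k + 1) → ℝ) :
    N.lipschitzKilling E Ω p (N.coord p a) =
      (-1) ^ n * ((Matrix.of fun i j => N.coordHeight E Ω p a (B (e i) (e j))).det /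
        E.vol p e ^ 2) := by
  set l := N.coordHeight E Ω p a with hl
  have hli := linearIndependent_of_map_ne_zero (E.vol p) he
  let b := Module.Basis.mk hli
    (hli.span_eq_top_of_card_eq_finrank' (by simp [finrank_tangentSpace])).ge
  have hb : ⇑b = e := Module.Basis.coe_mk hli _
  let R : Matrix (Fin n) (Fin n) ℝ := Matrix.of fun i j => b.repr (E.frame p i) j
  have hfr (i : Fin n) : E.frame p i = ∑ j, R i j • e j := by
    conv_lhs => rw [← b.sum_repr (E.frame p i)]
    rw [hb]
    rfl
  have hvol : E.vol p (E.frame p) = R.det * E.vol p e := by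
    rw [← map_sum_smul, ← funext hfr]
  have hR : R.det ≠ 0 := by
    intro h
    exact E.vol_frame_ne_zero p (by rw [hvol, h, zero_mul])
  have hmat : (Matrix.of fun i j => height Ω (N.gauss E p (N.coord p a))
      (N.fundamentalForm p (E.frame p i) (E.frame p j))) =
        R * (Matrix.of fun i j => l (B (e i) (e j))) * R.transpose := by
    ext i j
    rw [Matrix.of_apply, hB _ (N.height_gauss_coord_df E Ω p a), ← coordHeight_apply, ← hl, hfr i,
      hfr j]
    simp only [map_sum, map_smul, LinearMap.sum_apply, LinearMap.smul_apply, Matrix.mul_apply,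
      Matrix.of_apply, Matrix.transpose_apply, smul_eq_mul, Finset.sum_mul, Finset.mul_sum]
    refine Finset.sum_congr rfl fun i' _ => Finset.sum_congr rfl fun j' _ => ?_
    ring
  rw [lipschitzKilling, hmat, Matrix.det_mul, Matrix.det_mul, Matrix.det_transpose, hvol]
  field_simp

/-- The integral of `|G|` over the fibre as an integral over a solid ellipsoid of conormal
functionals. The functionals are parametrized by their values on a frame `ξ` of `N_p`. -/
theorem fibreIntegral_eq {N : TransversalBundle n f k} {E : EquiaffineStructure n M}
    {Ω : V [⋀^Fin (n + k + 1)]→ₗ[ℝ] ℝ} [FiniteDimensional ℝ V] (hN : N.Induces Ω E)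
    (S : UnitEllipsoid Ω)
    {w : Fin (n + k + 1) → V} (hS : ∀ φ, S.sq φ = ∑ l, height Ω φ (w l) ^ 2) (p : M)
    {e : Fin n → TangentSpace (𝓡 n) p} (he : E.vol p e ≠ 0)
    (B : TangentSpace (𝓡 n) p →ₗ[ℝ] TangentSpace (𝓡 n) p →ₗ[ℝ] V)
    (hB : ∀ l : V →ₗ[ℝ] ℝ, (∀ x, l (df n f p x) = 0) →
      ∀ x y, l (N.fundamentalForm p x y) = l (B x y))
    {ξ : Fin (k + 1) → N.fibre p} (hξ : N.vol p ξ ≠ 0)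
    (L : (Fin (k + 1) → ℝ) →ₗ[ℝ] V →ₗ[ℝ] ℝ) (hL : ∀ b x, L b (df n f p x) = 0)
    (hL' : ∀ b j, L b (ξ j) = b j) :
    ‖E.vol p e‖ₑ * N.fibreIntegral E S p = ((n + k + 1 : ℕ) : ℝ≥0∞) *
      ∫⁻ b in {b | 0 < ∑ l, L b (w l) ^ 2 ∧ ∑ l, L b (w l) ^ 2 < 1},
        ‖(Matrix.of fun i j => L b (B (e i) (e j))).det /
          Ω (Fin.append (n := k + 1) (fun i => df n f p (e i)) fun j => (ξ j : V))‖ₑ := by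
  set v := unimodularFrame (N.vol p) with hv
  have hv1 : N.vol p v = 1 := N.vol_unimodularFrame p
  have hv0 : N.vol p v ≠ 0 := by simp [hv1]
  -- the matrix of `ξ` in the frame `v`
  let P : Matrix (Fin (k + 1)) (Fin (k + 1)) ℝ :=
    Matrix.of fun j i => (N.basisOfVol p hv0).repr (ξ j) i
  have hξP (j : Fin (k + 1)) : ξ j = ∑ i, P j i • v i := by
    conv_lhs => rw [← (N.basisOfVol p hv0).sum_repr (ξ j)]
    rw [coe_basisOfVol]
    rfl
  have hδ : N.vol p ξ = P.det := by
    have := map_sum_smul (N.vol p) v P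
    rwa [← funext hξP, hv1, mul_one] at this
  have hvj (a : Fin (k + 1) → ℝ) (j : Fin (k + 1)) :
      N.coordHeight E Ω p a (v j) = (-1) ^ (k - (j : ℕ)) * a j :=
    height_gauss_coord_frame hN p a j
  let T : (Fin (k + 1) → ℝ) →ₗ[ℝ] (Fin (k + 1) → ℝ) :=
    LinearMap.pi fun j => (N.coordHeight E Ω p).flip (ξ j)
  have hT : T = Matrix.toLin' (P * Matrix.diagonal fun i : Fin (k + 1) => (-1) ^ (k - (i : ℕ))) := by
    ext a j
    simp only [T, LinearMap.comp_apply, LinearMap.pi_apply, LinearMap.flip_apply, hξP j]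
    simp only [Submodule.coe_sum, Submodule.coe_smul, map_sum, map_smul, hvj]
    simp only [Matrix.toLin'_apply, Matrix.mulVec, dotProduct, Matrix.mul_diagonal, smul_eq_mul,
      mul_assoc]
  have hTdet : ‖(LinearMap.det T)⁻¹‖ₑ = ‖(N.vol p ξ)⁻¹‖ₑ := by
    rw [hT, LinearMap.det_toLin', Matrix.det_mul, Matrix.det_diagonal, Finset.prod_pow_eq_pow_sum,
      hδ, Real.enorm_eq_ofReal_abs, Real.enorm_eq_ofReal_abs]
    simp [abs_mul]
  have hT0 : LinearMap.det T ≠ 0 := by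
    intro h
    rw [h] at hTdet
    simp only [inv_zero, enorm_zero] at hTdet
    exact inv_ne_zero hξ (enorm_eq_zero.1 hTdet.symm)
  have hLT (a : Fin (k + 1) → ℝ) : N.coordHeight E Ω p a = L (T a) := by
    refine N.conormal_ext p hξ (N.height_gauss_coord_df E Ω p a) (hL _) fun j => ?_
    rw [hL']
    rfl
  have hLc (x : V) : Continuous fun b => L b x :=
    (L.flip x).continuous_of_finiteDimensional
  have hdetc : Continuous fun b => (Matrix.of fun i j => L b (B (e i) (e j))).det :=
    Continuous.matrix_det (continuous_matrix fun i j => hLc _)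
  have hQc : Continuous fun b => ∑ l, L b (w l) ^ 2 :=
    continuous_finsetSum _ fun l _ => (hLc _).pow 2
  have hDm : MeasurableSet {b | 0 < ∑ l, L b (w l) ^ 2 ∧ ∑ l, L b (w l) ^ 2 < 1} :=
    (measurableSet_lt measurable_const hQc.measurable).inter
      (measurableSet_lt hQc.measurable measurable_const)
  have hTc : Continuous T := T.continuous_of_finiteDimensional
  have hG (a : Fin (k + 1) → ℝ) : ‖N.lipschitzKilling E Ω p (N.coord p a)‖ₑ =
      ‖(Matrix.of fun i j => L (T a) (B (e i) (e j))).det / E.vol p e ^ 2‖ₑ := by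
    rw [N.lipschitzKilling_coord E Ω p he B hB, hLT, enorm_mul]
    simp [Real.enorm_eq_ofReal_abs]
  have hm : Measurable fun b => ‖(Matrix.of fun i j => L b (B (e i) (e j))).det /
      E.vol p e ^ 2‖ₑ := (hdetc.div_const _).measurable.enorm
  have hsqT (a : Fin (k + 1) → ℝ) : S.sq (N.gauss E p (N.coord p a)) = ∑ l, L (T a) (w l) ^ 2 := by
    simp only [hS, ← coordHeight_apply, hLT]
  have hI : N.fibreIntegral E S p = ((n + k + 1 : ℕ) : ℝ≥0∞) *
      (‖(N.vol p ξ)⁻¹‖ₑ * ∫⁻ b in {b | 0 < ∑ l, L b (w l) ^ 2 ∧ ∑ l, L b (w l) ^ 2 < 1},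
        ‖(Matrix.of fun i j => L b (B (e i) (e j))).det / E.vol p e ^ 2‖ₑ) := by
    rw [fibreIntegral, fibreMeasure]
    simp only [hsqT, hG]
    rw [lintegral_ellipsoidMeasure n (Q := fun a => ∑ l, L (T a) (w l) ^ 2) (hQc.comp hTc),
      ← lintegral_indicator hDm, ← hTdet, ← lintegral_comp_linearMap T hT0 (hm.indicator hDm)]
    · rw [← lintegral_indicator]
      · rfl
      · exact hTc.measurable hDm
    · intro t a
      simp [mul_pow, Finset.mul_sum]
    · exact hm.comp hTc.measurable
    · intro t ht a
      have : (Matrix.of fun i j => L (T (t • a)) (B (e i) (e j))) =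
          t • Matrix.of fun i j => L (T a) (B (e i) (e j)) := by
        ext i j
        simp
      rw [this, Matrix.det_smul, Fintype.card_fin, mul_div_assoc, enorm_mul,
        Real.enorm_of_nonneg (by positivity)]
  rw [hI, append_eq_mul hN, mul_left_comm]
  congr 1
  rw [← mul_assoc, ← enorm_mul, ← lintegral_const_mul _ hm]
  refine lintegral_congr fun b => ?_
  rw [← enorm_mul]
  congr 1
  field_simp

end TransversalBundle

end Fibre

/-! ### The Gauss map of the conormal bundle in a chart -/

section ConormalChart

/-- The model `ℝⁿ × ℝᵏ⁺¹` of the conormal bundle in codimension `k + 1`. -/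
abbrev ConormalModel (n k : ℕ) : Type := EuclideanSpace ℝ (Fin n) × (Fin (k + 1) → ℝ)

variable {n k : ℕ} {V : Type*} [NormedAddCommGroup V] [NormedSpace ℝ V]

/-- The linear map `(x, c) ↦ dg(x) + ∑ cⱼ ξⱼ`. -/
def frameMap (g : EuclideanSpace ℝ (Fin n) → V) (ξ : Fin (k + 1) → EuclideanSpace ℝ (Fin n) → V)
    (u : EuclideanSpace ℝ (Fin n)) : ConormalModel n k →L[ℝ] V :=
  (fderiv ℝ g u) ∘L ContinuousLinearMap.fst ℝ _ _ +
    ∑ j, ((ContinuousLinearMap.proj (R := ℝ) (φ := fun _ : Fin (k + 1) => ℝ) j) ∘L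
      ContinuousLinearMap.snd ℝ (EuclideanSpace ℝ (Fin n)) _).smulRight (ξ j u)

theorem frameMap_apply (g : EuclideanSpace ℝ (Fin n) → V)
    (ξ : Fin (k + 1) → EuclideanSpace ℝ (Fin n) → V) (u : EuclideanSpace ℝ (Fin n))
    (y : ConormalModel n k) : frameMap g ξ u y = fderiv ℝ g u y.1 + ∑ j, y.2 j • ξ j u := by
  simp [frameMap]

/-- The pairing `(b, (x, c)) ↦ ∑ bⱼ cⱼ`. -/
def normalPairing (n k : ℕ) : (Fin (k + 1) → ℝ) →L[ℝ] ConormalModel n k →L[ℝ] ℝ :=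
  ∑ j, (ContinuousLinearMap.proj (R := ℝ) (φ := fun _ : Fin (k + 1) => ℝ) j).smulRight
    ((ContinuousLinearMap.proj (R := ℝ) (φ := fun _ : Fin (k + 1) => ℝ) j) ∘L
      ContinuousLinearMap.snd ℝ (EuclideanSpace ℝ (Fin n)) _)

theorem normalPairing_apply (b : Fin (k + 1) → ℝ) (y : ConormalModel n k) :
    normalPairing n k b y = ∑ j, b j * y.2 j := by
  simp [normalPairing]

/-- The functional on `V` that kills the image of `dg` at `u` and takes the values `bⱼ` on the
`ξⱼ`. -/
def conormal (g : EuclideanSpace ℝ (Fin n) → V) (ξ : Fin (k + 1) → EuclideanSpace ℝ (Fin n) → V)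
    (z : ConormalModel n k) : V →L[ℝ] ℝ :=
  (normalPairing n k z.2) ∘L (frameMap g ξ z.1).inverse

/-- The vectors `∂₁g, …, ∂ₙg, ξ₀, …, ξ_k` at `u`. -/
def adaptedFrame (g : EuclideanSpace ℝ (Fin n) → V)
    (ξ : Fin (k + 1) → EuclideanSpace ℝ (Fin n) → V) (u : EuclideanSpace ℝ (Fin n)) :
    Fin (n + k + 1) → V :=
  Fin.append (n := k + 1) (fun i => fderiv ℝ g u (EuclideanSpace.single i 1)) fun j => ξ j u

/-- The matrix of the Hessian of `l ∘ g`. -/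
def hessianMatrix (g : EuclideanSpace ℝ (Fin n) → V) (u : EuclideanSpace ℝ (Fin n))
    (l : V → ℝ) : Matrix (Fin n) (Fin n) ℝ :=
  Matrix.of fun i j =>
    l (fderiv ℝ (fderiv ℝ g) u (EuclideanSpace.single i 1) (EuclideanSpace.single j 1))

/-- The standard basis of `ℝⁿ × ℝᵏ⁺¹`. -/
def modelBasis (n k : ℕ) : Module.Basis (Fin n ⊕ Fin (k + 1)) ℝ (ConormalModel n k) :=
  (EuclideanSpace.basisFun (Fin n) ℝ).toBasis.prod (Pi.basisFun ℝ (Fin (k + 1)))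

@[simp] theorem modelBasis_inl (i : Fin n) :
    modelBasis n k (Sum.inl i) = (EuclideanSpace.single i 1, 0) := by
  simp [modelBasis]

@[simp] theorem modelBasis_inr (j : Fin (k + 1)) :
    modelBasis n k (Sum.inr j) = (0, Pi.single j 1) := by
  simp [modelBasis]

@[simp] theorem modelBasis_repr_inl (y : ConormalModel n k) (i : Fin n) :
    (modelBasis n k).repr y (Sum.inl i) = y.1 i := by
  simp [modelBasis]

@[simp] theorem modelBasis_repr_inr (y : ConormalModel n k) (j : Fin (k + 1)) :
    (modelBasis n k).repr y (Sum.inr j) = y.2 j := by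
  simp [modelBasis]

/-- The indices of tangential and normal coordinates in the coordinates of `V`. -/
def frameIndex (n k : ℕ) : Fin n ⊕ Fin (k + 1) ≃ Fin (n + k + 1) :=
  finSumFinEquiv (m := n) (n := k + 1)

theorem frameIndex_inl (i : Fin n) :
    frameIndex n k (Sum.inl i) = (Fin.castAdd (k + 1) i : Fin (n + (k + 1))) := rfl

theorem frameIndex_inr (j : Fin (k + 1)) :
    frameIndex n k (Sum.inr j) = (Fin.natAdd n j : Fin (n + (k + 1))) := rfl

theorem frameMap_modelBasis (g : EuclideanSpace ℝ (Fin n) → V)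
    (ξ : Fin (k + 1) → EuclideanSpace ℝ (Fin n) → V) (u : EuclideanSpace ℝ (Fin n))
    (i : Fin n ⊕ Fin (k + 1)) :
    frameMap g ξ u (modelBasis n k i) = adaptedFrame g ξ u (frameIndex n k i) := by
  rcases i with i | j
  · rw [frameMap_apply]
    refine Eq.trans ?_ (Fin.append_left (n := k + 1) _ _ i).symm
    simp
  · rw [frameMap_apply]
    refine Eq.trans ?_ (Fin.append_right (n := k + 1) _ _ j).symm
    simp [Pi.single_apply]

/-- The coordinates of a functional on `V` given by its values on a family `w`. -/
def evalFrame (w : Fin (n + k + 1) → V) : (V →L[ℝ] ℝ) →L[ℝ] ConormalModel n k :=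
  ContinuousLinearMap.prod
    ((EuclideanSpace.equiv (Fin n) ℝ).symm.toContinuousLinearMap ∘L
      ContinuousLinearMap.pi fun i =>
        ContinuousLinearMap.apply ℝ ℝ (w (Fin.castAdd (k + 1) i : Fin (n + (k + 1)))))
    (ContinuousLinearMap.pi fun j =>
      ContinuousLinearMap.apply ℝ ℝ (w (Fin.natAdd n j : Fin (n + (k + 1)))))

theorem modelBasis_repr_evalFrame (w : Fin (n + k + 1) → V) (l : V →L[ℝ] ℝ)
    (i : Fin n ⊕ Fin (k + 1)) :
    (modelBasis n k).repr (evalFrame w l) i = l (w (frameIndex n k i)) := by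
  rcases i with i | j
  · rw [modelBasis_repr_inl]
    simp [evalFrame, frameIndex_inl]
  · rw [modelBasis_repr_inr]
    simp [evalFrame, frameIndex_inr]

/-- The squared Euclidean norm on `ℝⁿ × ℝᵏ⁺¹`. -/
def modelSq (y : ConormalModel n k) : ℝ := ∑ i, y.1 i ^ 2 + ∑ j, y.2 j ^ 2

theorem modelSq_evalFrame (w : Fin (n + k + 1) → V) (l : V →L[ℝ] ℝ) :
    modelSq (evalFrame w l) = ∑ i, l (w i) ^ 2 := by
  have h := Fin.sum_univ_add (a := n) (b := k + 1) (fun i => l (w i) ^ 2)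
  refine Eq.trans ?_ h.symm
  simp [modelSq, evalFrame]

/-- The map that sends `(u, b)` to the coordinates of the corresponding conormal functional: the
Gauss map of the conormal bundle in a chart. -/
def conormalMap (g : EuclideanSpace ℝ (Fin n) → V)
    (ξ : Fin (k + 1) → EuclideanSpace ℝ (Fin n) → V) (w : Fin (n + k + 1) → V)
    (z : ConormalModel n k) : ConormalModel n k :=
  evalFrame w (conormal g ξ z)

variable [FiniteDimensional ℝ V]
  {g : EuclideanSpace ℝ (Fin n) → V} {ξ : Fin (k + 1) → EuclideanSpace ℝ (Fin n) → V}
  {W : Set (EuclideanSpace ℝ (Fin n))} {Ω : V [⋀^Fin (n + k + 1)]→ₗ[ℝ] ℝ}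
  {w : Fin (n + k + 1) → V}

theorem exists_frameMap_eq (hV : Module.finrank ℝ V = n + k + 1) {u : EuclideanSpace ℝ (Fin n)}
    (hu : Ω (adaptedFrame g ξ u) ≠ 0) :
    ∃ e : ConormalModel n k ≃L[ℝ] V, (e : ConormalModel n k →L[ℝ] V) = frameMap g ξ u := by
  have hli := (linearIndependent_of_map_ne_zero Ω hu).comp _ (frameIndex n k).injective
  let b := basisOfLinearIndependentOfCardEqFinrank hli (by simp [hV, add_assoc])
  have hb : ⇑b = adaptedFrame g ξ u ∘ frameIndex n k :=
    coe_basisOfLinearIndependentOfCardEqFinrank hli _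
  refine ⟨((modelBasis n k).equiv b (Equiv.refl _)).toContinuousLinearEquiv, ?_⟩
  apply ContinuousLinearMap.coe_injective
  refine (modelBasis n k).ext fun i => ?_
  refine Eq.trans ?_ (frameMap_modelBasis g ξ u i).symm
  have := (modelBasis n k).equiv_apply (b' := b) i (Equiv.refl _)
  refine Eq.trans this ?_
  rw [hb]
  rfl

theorem conormal_frameMap (hV : Module.finrank ℝ V = n + k + 1) {z : ConormalModel n k}
    (hu : Ω (adaptedFrame g ξ z.1) ≠ 0) (y : ConormalModel n k) :
    conormal g ξ z (frameMap g ξ z.1 y) = normalPairing n k z.2 y := by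
  obtain ⟨e, he⟩ := exists_frameMap_eq hV hu
  rw [conormal, ← he]
  simp

theorem conormal_fderiv (hV : Module.finrank ℝ V = n + k + 1) {z : ConormalModel n k}
    (hu : Ω (adaptedFrame g ξ z.1) ≠ 0) (x : EuclideanSpace ℝ (Fin n)) :
    conormal g ξ z (fderiv ℝ g z.1 x) = 0 := by
  have h := conormal_frameMap hV hu (x, 0)
  simpa [frameMap_apply, normalPairing_apply] using h

theorem conormal_normal (hV : Module.finrank ℝ V = n + k + 1) {z : ConormalModel n k}
    (hu : Ω (adaptedFrame g ξ z.1) ≠ 0) (j : Fin (k + 1)) :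
    conormal g ξ z (ξ j z.1) = z.2 j := by
  have h := conormal_frameMap hV hu (0, Pi.single j 1)
  simpa [frameMap_apply, normalPairing_apply, Pi.single_apply] using h

/-- Every functional that kills the image of `dg` arises from the frame `ξ`. -/
theorem conormal_eq (hV : Module.finrank ℝ V = n + k + 1) {u : EuclideanSpace ℝ (Fin n)}
    (hu : Ω (adaptedFrame g ξ u) ≠ 0) {l : V →L[ℝ] ℝ} (hl : ∀ x, l (fderiv ℝ g u x) = 0) :
    conormal g ξ (u, fun j => l (ξ j u)) = l := by
  obtain ⟨e, he⟩ := exists_frameMap_eq hV hu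
  ext v
  obtain ⟨y, rfl⟩ := e.surjective v
  have h : e y = frameMap g ξ u y := congrArg (fun φ => φ y) he
  have h2 := conormal_frameMap hV (z := (u, fun j => l (ξ j u))) hu y
  rw [h]
  refine h2.trans ?_
  simp [normalPairing_apply, frameMap_apply, hl, mul_comm]

theorem contDiffOn_frameMap (hW : IsOpen W) (hg : ContDiffOn ℝ ∞ g W)
    (hξ : ∀ j, ContDiffOn ℝ ∞ (ξ j) W) : ContDiffOn ℝ ∞ (frameMap g ξ) W := by
  have h1 : ContDiffOn ℝ ∞ (fderiv ℝ g) W := hg.fderiv_of_isOpen hW (by simp)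
  refine ContDiffOn.add (h1.clm_comp contDiffOn_const) (ContDiffOn.sum fun j _ => ?_)
  exact contDiffOn_const.smulRight (hξ j)

theorem contDiffOn_conormal (hV : Module.finrank ℝ V = n + k + 1) (hW : IsOpen W)
    (hg : ContDiffOn ℝ ∞ g W) (hξ : ∀ j, ContDiffOn ℝ ∞ (ξ j) W)
    (hΩ : ∀ u ∈ W, Ω (adaptedFrame g ξ u) ≠ 0) :
    ContDiffOn ℝ ∞ (conormal (k := k) g ξ) (W ×ˢ Set.univ) := by
  have h1 : ContDiffOn ℝ ∞ (fun z : ConormalModel n k => (frameMap g ξ z.1).inverse)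
      (W ×ˢ Set.univ) := by
    intro z hz
    obtain ⟨e, he⟩ := exists_frameMap_eq hV (hΩ z.1 hz.1)
    have h2 : ContDiffAt ℝ ∞ ContinuousLinearMap.inverse (frameMap g ξ z.1) := by
      rw [← he]
      exact contDiffAt_map_inverse e
    have h3 : ContDiffAt ℝ ∞ (frameMap g ξ) z.1 :=
      (contDiffOn_frameMap hW hg hξ).contDiffAt (hW.mem_nhds hz.1)
    exact (h2.comp z (h3.comp z contDiffAt_fst)).contDiffWithinAt
  refine ContDiffOn.clm_comp ?_ h1
  exact ((normalPairing n k).contDiff.comp contDiff_snd).contDiffOn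

theorem contDiffOn_conormalMap (hV : Module.finrank ℝ V = n + k + 1) (hW : IsOpen W)
    (hg : ContDiffOn ℝ ∞ g W) (hξ : ∀ j, ContDiffOn ℝ ∞ (ξ j) W)
    (hΩ : ∀ u ∈ W, Ω (adaptedFrame g ξ u) ≠ 0) :
    ContDiffOn ℝ ∞ (conormalMap (k := k) g ξ w) (W ×ˢ Set.univ) :=
  (evalFrame w).contDiff.comp_contDiffOn (contDiffOn_conormal hV hW hg hξ hΩ)

/-- The derivative of the defining equation of the conormal functionals. -/
theorem fderiv_conormal_frameMap (hV : Module.finrank ℝ V = n + k + 1) (hW : IsOpen W)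
    (hg : ContDiffOn ℝ ∞ g W) (hξ : ∀ j, ContDiffOn ℝ ∞ (ξ j) W)
    (hΩ : ∀ u ∈ W, Ω (adaptedFrame g ξ u) ≠ 0) {z : ConormalModel n k} (hz : z.1 ∈ W)
    (z' y : ConormalModel n k) :
    fderiv ℝ (conormal g ξ) z z' (frameMap g ξ z.1 y) +
      conormal g ξ z (fderiv ℝ (frameMap g ξ) z.1 z'.1 y) = normalPairing n k z'.2 y := by
  have hO : IsOpen (W ×ˢ (Set.univ : Set (Fin (k + 1) → ℝ))) := hW.prod isOpen_univ
  have hzO : z ∈ W ×ˢ (Set.univ : Set (Fin (k + 1) → ℝ)) := ⟨hz, trivial⟩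
  have h1 : HasFDerivAt (conormal g ξ) (fderiv ℝ (conormal g ξ) z) z :=
    (((contDiffOn_conormal hV hW hg hξ hΩ).contDiffAt (hO.mem_nhds hzO)).differentiableAt
      (by simp)).hasFDerivAt
  have h2 : HasFDerivAt (frameMap g ξ) (fderiv ℝ (frameMap g ξ) z.1) z.1 :=
    (((contDiffOn_frameMap hW hg hξ).contDiffAt (hW.mem_nhds hz)).differentiableAt
      (by simp)).hasFDerivAt
  have h3 : HasFDerivAt (fun z : ConormalModel n k => frameMap g ξ z.1 y)
      ((ContinuousLinearMap.apply ℝ V y) ∘L (fderiv ℝ (frameMap g ξ) z.1) ∘L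
        ContinuousLinearMap.fst ℝ _ _) z :=
    (ContinuousLinearMap.apply ℝ V y).hasFDerivAt.comp z (h2.comp z hasFDerivAt_fst)
  have h4 := h1.clm_apply h3
  have h5 : HasFDerivAt (fun z : ConormalModel n k => normalPairing n k z.2 y)
      ((ContinuousLinearMap.apply ℝ ℝ y) ∘L (normalPairing n k) ∘L
        ContinuousLinearMap.snd ℝ _ _) z :=
    (ContinuousLinearMap.apply ℝ ℝ y).hasFDerivAt.comp z
      ((normalPairing n k).hasFDerivAt.comp z hasFDerivAt_snd)
  have h6 : (fun z : ConormalModel n k => conormal g ξ z (frameMap g ξ z.1 y)) =ᶠ[nhds z]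
      fun z => normalPairing n k z.2 y := by
    filter_upwards [hO.mem_nhds hzO] with a ha
    exact conormal_frameMap hV (hΩ a.1 ha.1) y
  have h7 := congrArg (fun φ => φ z') ((h4.congr_of_eventuallyEq h6.symm).unique h5)
  simpa [add_comm] using h7

theorem fderiv_frameMap_inl (hW : IsOpen W) (hg : ContDiffOn ℝ ∞ g W)
    (hξ : ∀ j, ContDiffOn ℝ ∞ (ξ j) W) {u : EuclideanSpace ℝ (Fin n)} (hu : u ∈ W)
    (x x' : EuclideanSpace ℝ (Fin n)) :
    fderiv ℝ (frameMap g ξ) u x' ((x, 0) : ConormalModel n k) = fderiv ℝ (fderiv ℝ g) u x' x := by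
  have h2 : HasFDerivAt (frameMap g ξ) (fderiv ℝ (frameMap g ξ) u) u :=
    (((contDiffOn_frameMap hW hg hξ).contDiffAt (hW.mem_nhds hu)).differentiableAt
      (by simp)).hasFDerivAt
  have h3 := (ContinuousLinearMap.apply ℝ V ((x, 0) : ConormalModel n k)).hasFDerivAt.comp u h2
  have h4 : HasFDerivAt (fderiv ℝ g) (fderiv ℝ (fderiv ℝ g) u) u :=
    (((hg.fderiv_of_isOpen hW (m := ∞) (by simp)).contDiffAt (hW.mem_nhds hu)).differentiableAt
      (by simp)).hasFDerivAt
  have h5 := (ContinuousLinearMap.apply ℝ V x).hasFDerivAt.comp u h4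
  have h6 : ((ContinuousLinearMap.apply ℝ V ((x, 0) : ConormalModel n k)) ∘ frameMap g ξ) =
      (ContinuousLinearMap.apply ℝ V x) ∘ fderiv ℝ g := by
    funext a
    simp [frameMap_apply]
  rw [h6] at h3
  simpa using congrArg (fun φ => φ x') (h3.unique h5)

/-- The Jacobian of the Gauss map in a chart is, up to sign, the Hessian determinant of the height
function divided by the volume of the adapted frame. -/
theorem abs_det_fderiv_conormalMap (hV : Module.finrank ℝ V = n + k + 1) (hW : IsOpen W)
    (hg : ContDiffOn ℝ ∞ g W) (hξ : ∀ j, ContDiffOn ℝ ∞ (ξ j) W)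
    (hΩ : ∀ u ∈ W, Ω (adaptedFrame g ξ u) ≠ 0) (hw : Ω w = 1) {z : ConormalModel n k}
    (hz : z.1 ∈ W) :
    |(fderiv ℝ (conormalMap g ξ w) z).det| =
      |(hessianMatrix g z.1 (conormal g ξ z)).det / Ω (adaptedFrame g ξ z.1)| := by
  have hO : IsOpen (W ×ˢ (Set.univ : Set (Fin (k + 1) → ℝ))) := hW.prod isOpen_univ
  have hzO : z ∈ W ×ˢ (Set.univ : Set (Fin (k + 1) → ℝ)) := ⟨hz, trivial⟩
  have h1 : HasFDerivAt (conormal g ξ) (fderiv ℝ (conormal g ξ) z) z :=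
    (((contDiffOn_conormal hV hW hg hξ hΩ).contDiffAt (hO.mem_nhds hzO)).differentiableAt
      (by simp)).hasFDerivAt
  have hF : fderiv ℝ (conormalMap g ξ w) z = (evalFrame w) ∘L fderiv ℝ (conormal g ξ) z :=
    ((evalFrame w).hasFDerivAt.comp z h1).fderiv
  set ℓ' := fderiv ℝ (conormal g ξ) z with hℓ'
  set D := Ω (adaptedFrame g ξ z.1) with hD
  have hD0 : D ≠ 0 := hΩ z.1 hz
  -- the matrix of `w` in the adapted frame
  have hli := linearIndependent_of_map_ne_zero Ω hD0
  let b := basisOfLinearIndependentOfCardEqFinrank hli (by simp [hV])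
  have hb : ⇑b = adaptedFrame g ξ z.1 := coe_basisOfLinearIndependentOfCardEqFinrank hli _
  let C : Matrix (Fin (n + k + 1)) (Fin (n + k + 1)) ℝ := Matrix.of fun i j => b.repr (w i) j
  have hwC (i) : w i = ∑ j, C i j • adaptedFrame g ξ z.1 j := by
    conv_lhs => rw [← b.sum_repr (w i)]
    rw [hb]
    rfl
  have hC : C.det * D = 1 := by
    rw [hD, ← map_sum_smul, ← funext hwC, hw]
  let K : Matrix (Fin n ⊕ Fin (k + 1)) (Fin n ⊕ Fin (k + 1)) ℝ := Matrix.of fun i j =>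
    ℓ' (modelBasis n k i) (frameMap g ξ z.1 (modelBasis n k j))
  have hmat : LinearMap.toMatrix (modelBasis n k) (modelBasis n k)
      (fderiv ℝ (conormalMap g ξ w) z).toLinearMap =
        C.submatrix (frameIndex n k) (frameIndex n k) * K.transpose := by
    ext i j
    rw [LinearMap.toMatrix_apply, hF]
    refine (modelBasis_repr_evalFrame w _ i).trans ?_
    rw [hwC, map_sum, Matrix.mul_apply, ← (frameIndex n k).sum_comp]
    refine Finset.sum_congr rfl fun m _ => ?_
    rw [map_smul, Matrix.submatrix_apply, Matrix.transpose_apply, ← frameMap_modelBasis]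
    rfl
  have hK : K = Matrix.fromBlocks (-hessianMatrix g z.1 (conormal g ξ z))
      (Matrix.of fun i j => K (Sum.inl i) (Sum.inr j)) 0 1 := by
    have hk (i j) := fderiv_conormal_frameMap hV hW hg hξ hΩ hz (modelBasis n k i)
      (modelBasis n k j)
    ext (i | i) (j | j)
    · have h := hk (Sum.inl i) (Sum.inl j)
      rw [modelBasis_inl, modelBasis_inl, fderiv_frameMap_inl hW hg hξ hz] at h
      simp only [normalPairing_apply, Pi.zero_apply, mul_zero, Finset.sum_const_zero] at h
      simp only [K, Matrix.of_apply, Matrix.fromBlocks_apply₁₁, Matrix.neg_apply, hessianMatrix,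
        modelBasis_inl]
      linarith
    · simp
    · have h := hk (Sum.inr i) (Sum.inl j)
      rw [modelBasis_inl, modelBasis_inr, fderiv_frameMap_inl hW hg hξ hz] at h
      simpa [normalPairing_apply, K] using h
    · have h := hk (Sum.inr i) (Sum.inr j)
      rw [modelBasis_inr, modelBasis_inr] at h
      simpa [normalPairing_apply, K, Pi.single_apply, Matrix.one_apply, eq_comm] using h
  have hKdet : |K.det| = |(hessianMatrix g z.1 (conormal g ξ z)).det| := by
    rw [hK, Matrix.det_fromBlocks_zero₂₁, Matrix.det_neg]
    simp [abs_mul]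
  rw [ContinuousLinearMap.det, ← LinearMap.det_toMatrix (modelBasis n k), hmat, Matrix.det_mul,
    Matrix.det_transpose, Matrix.det_submatrix_equiv_self, abs_mul, hKdet, abs_div,
    eq_div_iff (abs_ne_zero.2 hD0), mul_right_comm, ← abs_mul, hC]
  simp

end ConormalChart

/-! ### Derivatives in charts -/

section Charts

variable {n : ℕ} {M : Type*} [TopologicalSpace M] [ChartedSpace (EuclideanSpace ℝ (Fin n)) M]
  [IsManifold (𝓡 n) ∞ M] {V : Type*} [NormedAddCommGroup V] [NormedSpace ℝ V] {k : ℕ} {f : M → V}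

/-- The vector of `T_pM` with coordinates `v` in the chart around `c`. -/
def chartVector (c p : M) (v : EuclideanSpace ℝ (Fin n)) : TangentSpace (𝓡 n) p :=
  (trivializationAt (EuclideanSpace ℝ (Fin n)) (TangentSpace (𝓡 n)) c).symmL ℝ p v

theorem mfderiv_chart_symm (c : M) {u : EuclideanSpace ℝ (Fin n)}
    (hu : u ∈ (chartAt (EuclideanSpace ℝ (Fin n)) c).target) (v : EuclideanSpace ℝ (Fin n)) :
    mfderiv 𝓘(ℝ, EuclideanSpace ℝ (Fin n)) (𝓡 n)
      (chartAt (EuclideanSpace ℝ (Fin n)) c).symm u v =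
        chartVector c ((chartAt (EuclideanSpace ℝ (Fin n)) c).symm u) v := by
  have hx := (chartAt (EuclideanSpace ℝ (Fin n)) c).map_target hu
  rw [chartVector, TangentBundle.symmL_trivializationAt hx]
  simp only [extChartAt, OpenPartialHomeomorph.extend, modelWithCornersSelf_partialEquiv,
    modelWithCornersSelf_coe, Set.range_id, mfderivWithin_univ]
  exact congrArg (fun a => (mfderiv 𝓘(ℝ, EuclideanSpace ℝ (Fin n)) (𝓡 n)
    (chartAt (EuclideanSpace ℝ (Fin n)) c).symm a :
      EuclideanSpace ℝ (Fin n) →L[ℝ] EuclideanSpace ℝ (Fin n)) v)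
    ((chartAt (EuclideanSpace ℝ (Fin n)) c).right_inv hu).symm

theorem mfderiv_chart (c : M) {p : M} (hp : p ∈ (chartAt (EuclideanSpace ℝ (Fin n)) c).source)
    (y : TangentSpace (𝓡 n) p) :
    mfderiv (𝓡 n) (𝓡 n) (chartAt (EuclideanSpace ℝ (Fin n)) c) p y =
      (trivializationAt (EuclideanSpace ℝ (Fin n)) (TangentSpace (𝓡 n)) c ⟨p, y⟩).2 := by
  have h := TangentBundle.continuousLinearMapAt_trivializationAt (I := 𝓡 n) hp
  have h2 := congrArg (fun φ => φ y) h
  have h3 : p ∈ (trivializationAt (EuclideanSpace ℝ (Fin n)) (TangentSpace (𝓡 n) : M → Type _)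
    c).baseSet := hp
  exact h2.symm.trans (congrFun (Bundle.Trivialization.coe_linearMapAt_of_mem (R := ℝ) _ h3) y)

theorem df_chart_symm (hf : ContMDiff (𝓡 n) 𝓘(ℝ, V) ∞ f) (c : M) {u : EuclideanSpace ℝ (Fin n)}
    (hu : u ∈ (chartAt (EuclideanSpace ℝ (Fin n)) c).target) (v : EuclideanSpace ℝ (Fin n)) :
    df n f ((chartAt (EuclideanSpace ℝ (Fin n)) c).symm u)
      (mfderiv 𝓘(ℝ, EuclideanSpace ℝ (Fin n)) (𝓡 n)
        (chartAt (EuclideanSpace ℝ (Fin n)) c).symm u v) =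
      fderiv ℝ (f ∘ (chartAt (EuclideanSpace ℝ (Fin n)) c).symm) u v := by
  have h := mfderiv_comp_apply u ((hf.mdifferentiable (by simp)) _)
    (mdifferentiableAt_atlas_symm (I := 𝓡 n) (chart_mem_atlas _ c) hu) v
  rw [mfderiv_eq_fderiv] at h
  exact h.symm

theorem df_eq_fderiv (hf : ContMDiff (𝓡 n) 𝓘(ℝ, V) ∞ f) (c : M) {p : M}
    (hp : p ∈ (chartAt (EuclideanSpace ℝ (Fin n)) c).source) (y : TangentSpace (𝓡 n) p) :
    df n f p y = fderiv ℝ (f ∘ (chartAt (EuclideanSpace ℝ (Fin n)) c).symm)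
      (chartAt (EuclideanSpace ℝ (Fin n)) c p)
      (mfderiv (𝓡 n) (𝓡 n) (chartAt (EuclideanSpace ℝ (Fin n)) c) p y) := by
  set e := chartAt (EuclideanSpace ℝ (Fin n)) c with he
  have hd := mdifferentiableAt_atlas (I := 𝓡 n) (chart_mem_atlas _ c) hp
  have hu : e p ∈ e.target := e.map_source hp
  have hc : ContMDiffAt 𝓘(ℝ, EuclideanSpace ℝ (Fin n)) 𝓘(ℝ, V) ∞ (f ∘ e.symm) (e p) :=
    hf.contMDiffAt.comp (e p) ((contMDiffOn_chart_symm (I := 𝓡 n) (x := c)).contMDiffAt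
      (e.open_target.mem_nhds hu))
  have h := mfderiv_comp_apply p (hc.mdifferentiableAt (by simp)) hd y
  rw [mfderiv_eq_fderiv] at h
  have h2 : (f ∘ e.symm) ∘ e =ᶠ[nhds p] f := by
    filter_upwards [e.open_source.mem_nhds hp] with q hq
    simp [e.left_inv hq]
  rw [h2.mfderiv_eq] at h
  exact h

theorem contDiffOn_comp_chart_symm {U : Set M} {h : M → V} (hh : ContMDiffOn (𝓡 n) 𝓘(ℝ, V) ∞ h U)
    (c : M) : ContDiffOn ℝ ∞ (h ∘ (chartAt (EuclideanSpace ℝ (Fin n)) c).symm)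
      ((chartAt (EuclideanSpace ℝ (Fin n)) c).target ∩
        (chartAt (EuclideanSpace ℝ (Fin n)) c).symm ⁻¹' U) := by
  rw [← contMDiffOn_iff_contDiffOn]
  exact hh.comp ((contMDiffOn_chart_symm (I := 𝓡 n) (x := c)).mono Set.inter_subset_left)
    fun u hu => hu.2

/-- The density of the volume element in a chart is continuous. -/
theorem EquiaffineStructure.continuousOn_density [T2Space M] (E : EquiaffineStructure n M)
    (c : M) :
    ContinuousOn (fun u => E.vol ((chartAt (EuclideanSpace ℝ (Fin n)) c).symm u) fun i =>
      mfderiv 𝓘(ℝ, EuclideanSpace ℝ (Fin n)) (𝓡 n)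
        (chartAt (EuclideanSpace ℝ (Fin n)) c).symm u (EuclideanSpace.single i 1))
      (chartAt (EuclideanSpace ℝ (Fin n)) c).target := by
  set e := chartAt (EuclideanSpace ℝ (Fin n)) c with he
  set t := trivializationAt (EuclideanSpace ℝ (Fin n)) (TangentSpace (𝓡 n) : M → Type _) c with ht
  set b := (EuclideanSpace.basisFun (Fin n) ℝ).toBasis
  intro u₀ hu₀
  have hp₀ : e.symm u₀ ∈ e.source := e.map_target hu₀
  obtain ⟨ψ, -, hψ⟩ := (SmoothBumpFunction.nhds_basis_tsupport (I := 𝓡 n) (e.symm u₀)).mem_iff.1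
    (e.open_source.mem_nhds hp₀)
  let Y : Fin n → Π p : M, TangentSpace (𝓡 n) p := fun i => (ψ : M → ℝ) • t.localFrame b i
  have hY (i) : IsSmoothField (Y i) := by
    refine ContMDiffOn.smul_section_of_tsupport (u := e.source) ψ.contMDiff.contMDiffOn
      e.open_source hψ ?_
    exact t.contMDiffOn_localFrame_baseSet ∞ b i
  have h1 : ContinuousAt (fun p => E.vol p fun i => Y i p) (e.symm u₀) :=
    (E.smooth_vol Y hY).continuous.continuousAt
  have h2 : ContinuousAt (fun u => E.vol (e.symm u) fun i => Y i (e.symm u)) u₀ :=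
    ContinuousAt.comp (f := e.symm) h1 (e.continuousAt_symm hu₀)
  refine (h2.congr ?_).continuousWithinAt
  have h3 : ∀ᶠ u in nhds u₀, ψ (e.symm u) = 1 :=
    (e.continuousAt_symm hu₀).eventually ψ.eventuallyEq_one
  filter_upwards [h3, e.open_target.mem_nhds hu₀] with u hu hut
  congr 1
  funext i
  have hs : e.symm u ∈ t.baseSet := e.map_target hut
  rw [mfderiv_chart_symm c hut]
  simp only [Y, Pi.smul_apply', hu, one_smul]
  rw [t.localFrame_apply_of_mem_baseSet b hs]
  simp [b, Bundle.Trivialization.basisAt, chartVector]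
  exact (t.symmL_apply (R := ℝ) hs _).symm

/-- A conormal functional takes the same values on `∇̃_x df(Y)` as on the second derivative of `f`
in a chart. -/
theorem conormal_flatDeriv (hf : ContMDiff (𝓡 n) 𝓘(ℝ, V) ∞ f) (c : M) {p : M}
    (hp : p ∈ (chartAt (EuclideanSpace ℝ (Fin n)) c).source)
    {Y : Π p : M, TangentSpace (𝓡 n) p}
    (hY : MDifferentiableAt (𝓡 n) ((𝓡 n).prod 𝓘(ℝ, EuclideanSpace ℝ (Fin n)))
      (fun p => (⟨p, Y p⟩ : TangentBundle (𝓡 n) M)) p) (x : TangentSpace (𝓡 n) p)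
    {l : V →ₗ[ℝ] ℝ} (hl : ∀ y, l (df n f p y) = 0) :
    l (flatDeriv n f Y p x) =
      l (fderiv ℝ (fderiv ℝ (f ∘ (chartAt (EuclideanSpace ℝ (Fin n)) c).symm))
        (chartAt (EuclideanSpace ℝ (Fin n)) c p)
        (mfderiv (𝓡 n) (𝓡 n) (chartAt (EuclideanSpace ℝ (Fin n)) c) p x)
        (mfderiv (𝓡 n) (𝓡 n) (chartAt (EuclideanSpace ℝ (Fin n)) c) p (Y p))) := by
  set e := chartAt (EuclideanSpace ℝ (Fin n)) c with he
  set t := trivializationAt (EuclideanSpace ℝ (Fin n)) (TangentSpace (𝓡 n) : M → Type _) c with ht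
  set g := f ∘ e.symm with hg
  have hu : e p ∈ e.target := e.map_source hp
  have hd := mdifferentiableAt_atlas (I := 𝓡 n) (chart_mem_atlas _ c) hp
  have hds := mdifferentiableAt_atlas_symm (I := 𝓡 n) (chart_mem_atlas _ c) hu
  -- the coordinates of the field in the chart
  let y : M → EuclideanSpace ℝ (Fin n) := fun q => (t ⟨q, Y q⟩).2
  have hy (q : M) (hq : q ∈ e.source) : mfderiv (𝓡 n) (𝓡 n) e q (Y q) = y q :=
    mfderiv_chart c hq (Y q)
  have hyd : MDifferentiableAt (𝓡 n) 𝓘(ℝ, EuclideanSpace ℝ (Fin n)) y p :=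
    (t.mdifferentiableAt_section_iff (𝓡 n) Y hp).1 hY
  have hyu : DifferentiableAt ℝ (y ∘ e.symm) (e p) := by
    rw [← mdifferentiableAt_iff_differentiableAt]
    refine MDifferentiableAt.comp (e p) ?_ hds
    rwa [e.left_inv hp]
  have hgc : ContDiffOn ℝ ∞ g e.target := by
    have := contDiffOn_comp_chart_symm (hf.contMDiffOn (s := Set.univ)) c
    simpa using this
  have hg2 : HasFDerivAt (fderiv ℝ g) (fderiv ℝ (fderiv ℝ g) (e p)) (e p) :=
    (((hgc.fderiv_of_isOpen e.open_target (m := ∞) (by simp)).contDiffAt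
      (e.open_target.mem_nhds hu)).differentiableAt (by simp)).hasFDerivAt
  have hH := hg2.clm_apply hyu.hasFDerivAt
  have hkey : flatDeriv n f Y p x = fderiv ℝ (fun u => fderiv ℝ g u ((y ∘ e.symm) u)) (e p)
      (mfderiv (𝓡 n) (𝓡 n) e p x) := by
    have h1 := mfderiv_comp_apply p hH.differentiableAt.mdifferentiableAt hd x
    rw [mfderiv_eq_fderiv] at h1
    have h2 : (fun u => fderiv ℝ g u ((y ∘ e.symm) u)) ∘ e =ᶠ[nhds p] fun q => df n f q (Y q) := by
      filter_upwards [e.open_source.mem_nhds hp] with q hq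
      rw [df_eq_fderiv hf c hq, hy q hq]
      simp [e.left_inv hq, ← hg, ← he]
    rw [h2.mfderiv_eq] at h1
    exact h1
  have hl' (v : EuclideanSpace ℝ (Fin n)) : l (fderiv ℝ g (e p) v) = 0 := by
    rw [← df_chart_symm hf c hu v]
    have h3 : e.symm (e p) = p := e.left_inv hp
    have h4 : ∀ q, q = p → ∀ y, l (df n f q y) = 0 := by
      rintro q rfl
      exact hl
    exact h4 _ h3 _
  rw [hkey, hH.fderiv, hy p hp]
  change l (fderiv ℝ g (e p) _ + fderiv ℝ (fderiv ℝ g) (e p) _ (y (e.symm (e p)))) = _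
  rw [map_add, hl', zero_add, e.left_inv hp]

theorem conormal_fundamentalForm (hf : ContMDiff (𝓡 n) 𝓘(ℝ, V) ∞ f)
    (N : TransversalBundle n f k) (c : M) {p : M}
    (hp : p ∈ (chartAt (EuclideanSpace ℝ (Fin n)) c).source) (x y : TangentSpace (𝓡 n) p)
    {l : V →ₗ[ℝ] ℝ} (hl : ∀ y, l (df n f p y) = 0) :
    l (N.fundamentalForm p x y) =
      l (fderiv ℝ (fderiv ℝ (f ∘ (chartAt (EuclideanSpace ℝ (Fin n)) c).symm))
        (chartAt (EuclideanSpace ℝ (Fin n)) c p)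
        (mfderiv (𝓡 n) (𝓡 n) (chartAt (EuclideanSpace ℝ (Fin n)) c) p x)
        (mfderiv (𝓡 n) (𝓡 n) (chartAt (EuclideanSpace ℝ (Fin n)) c) p y)) := by
  have h1 := conormal_flatDeriv hf c hp
    (Y := FiberBundle.extend (EuclideanSpace ℝ (Fin n)) y)
    (FiberBundle.mdifferentiableAt_extend (𝓡 n) (EuclideanSpace ℝ (Fin n)) y) x hl
  rw [FiberBundle.extend_apply_self] at h1
  rw [← h1, TransversalBundle.fundamentalForm]
  set v := flatDeriv n f (FiberBundle.extend (EuclideanSpace ℝ (Fin n)) y) p x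
  have h2 : v - (N.fibre p).projection (LinearMap.range (df n f p)) (N.isCompl p).symm v ∈
      LinearMap.range (df n f p) := by
    rw [← Submodule.projection_apply_eq_zero_iff (N.isCompl p).symm, map_sub,
      Submodule.projection_apply_of_mem_left _ (Submodule.projection_apply_mem _ v), sub_self]
  obtain ⟨z, hz⟩ := h2
  have h3 := hl z
  rw [hz, map_sub, sub_eq_zero] at h3
  exact h3.symm

end Charts

/-! ### The fibre integral in a chart -/

section ChartIntegral

open MeasureTheory

variable {n : ℕ} {M : Type*} [TopologicalSpace M] [ChartedSpace (EuclideanSpace ℝ (Fin n)) M]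
  [IsManifold (𝓡 n) ∞ M] {V : Type*} [NormedAddCommGroup V] [NormedSpace ℝ V] {k : ℕ} {f : M → V}

/-- The coordinate vector `∂ᵢ` of the chart around `c` at the point with coordinates `u`. -/
def coordVector (c : M) (u : EuclideanSpace ℝ (Fin n)) (i : Fin n) :
    TangentSpace (𝓡 n) ((chartAt (EuclideanSpace ℝ (Fin n)) c).symm u) :=
  mfderiv 𝓘(ℝ, EuclideanSpace ℝ (Fin n)) (𝓡 n) (chartAt (EuclideanSpace ℝ (Fin n)) c).symm u
    (EuclideanSpace.single i 1)

theorem mfderiv_coordVector (c : M) {u : EuclideanSpace ℝ (Fin n)}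
    (hu : u ∈ (chartAt (EuclideanSpace ℝ (Fin n)) c).target) (i : Fin n) :
    mfderiv (𝓡 n) (𝓡 n) (chartAt (EuclideanSpace ℝ (Fin n)) c)
      ((chartAt (EuclideanSpace ℝ (Fin n)) c).symm u) (coordVector c u i) =
        EuclideanSpace.single i (1 : ℝ) := by
  have h := (mdifferentiable_chart (I := 𝓡 n) c).comp_symm_deriv hu
  exact congrArg (fun φ => φ (EuclideanSpace.single i (1 : ℝ))) h

theorem linearIndependent_coordVector (c : M) {u : EuclideanSpace ℝ (Fin n)}
    (hu : u ∈ (chartAt (EuclideanSpace ℝ (Fin n)) c).target) :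
    LinearIndependent ℝ (coordVector c u) := by
  have h := (EuclideanSpace.basisFun (Fin n) ℝ).toBasis.linearIndependent.map'
    (mfderiv 𝓘(ℝ, EuclideanSpace ℝ (Fin n)) (𝓡 n)
      (chartAt (EuclideanSpace ℝ (Fin n)) c).symm u).toLinearMap
    ((mdifferentiable_chart (I := 𝓡 n) c).symm.ker_mfderiv_eq_bot hu)
  have h2 : coordVector c u = (mfderiv 𝓘(ℝ, EuclideanSpace ℝ (Fin n)) (𝓡 n)
      (chartAt (EuclideanSpace ℝ (Fin n)) c).symm u).toLinearMap ∘
        (EuclideanSpace.basisFun (Fin n) ℝ).toBasis := by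
    funext i
    have hb : EuclideanSpace.single i (1 : ℝ) = (EuclideanSpace.basisFun (Fin n) ℝ).toBasis i := by
      simp
    exact congrArg (mfderiv 𝓘(ℝ, EuclideanSpace ℝ (Fin n)) (𝓡 n)
      (chartAt (EuclideanSpace ℝ (Fin n)) c).symm u) hb
  rw [h2]
  exact h

theorem EquiaffineStructure.vol_coordVector_ne_zero (E : EquiaffineStructure n M) (c : M)
    {u : EuclideanSpace ℝ (Fin n)} (hu : u ∈ (chartAt (EuclideanSpace ℝ (Fin n)) c).target) :
    E.vol _ (coordVector c u) ≠ 0 :=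
  map_ne_zero_of_linearIndependent (finrank_tangentSpace _) (E.vol_ne_zero _)
    (linearIndependent_coordVector c hu)

/-- A conormal functional in the chart is a conormal functional on the manifold. -/
theorem df_eq_zero_iff (hf : ContMDiff (𝓡 n) 𝓘(ℝ, V) ∞ f) (c : M) {u : EuclideanSpace ℝ (Fin n)}
    (hu : u ∈ (chartAt (EuclideanSpace ℝ (Fin n)) c).target) (l : V →ₗ[ℝ] ℝ) :
    (∀ x, l (df n f ((chartAt (EuclideanSpace ℝ (Fin n)) c).symm u) x) = 0) ↔
      ∀ x, l (fderiv ℝ (f ∘ (chartAt (EuclideanSpace ℝ (Fin n)) c).symm) u x) = 0 := by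
  constructor
  · intro h x
    rw [← df_chart_symm hf c hu x]
    exact h _
  · intro h x
    rw [df_eq_fderiv hf c ((chartAt (EuclideanSpace ℝ (Fin n)) c).map_target hu),
      (chartAt (EuclideanSpace ℝ (Fin n)) c).right_inv hu]
    exact h _

/-- The second derivative of `f` in the chart around `c`, as a bilinear map on `T_pM`. -/
def chartHessian (f : M → V) (c p : M) :
    TangentSpace (𝓡 n) p →ₗ[ℝ] TangentSpace (𝓡 n) p →ₗ[ℝ] V :=
  let A : TangentSpace (𝓡 n) p →ₗ[ℝ] EuclideanSpace ℝ (Fin n) :=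
    (mfderiv (𝓡 n) (𝓡 n) (chartAt (EuclideanSpace ℝ (Fin n)) c) p).toLinearMap
  ((ContinuousLinearMap.coeLM ℝ) ∘ₗ
    (fderiv ℝ (fderiv ℝ (f ∘ (chartAt (EuclideanSpace ℝ (Fin n)) c).symm))
      (chartAt (EuclideanSpace ℝ (Fin n)) c p)).toLinearMap).compl₁₂ A A

theorem chartHessian_apply (f : M → V) (c p : M) (x y : TangentSpace (𝓡 n) p) :
    chartHessian f c p x y =
      fderiv ℝ (fderiv ℝ (f ∘ (chartAt (EuclideanSpace ℝ (Fin n)) c).symm))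
        (chartAt (EuclideanSpace ℝ (Fin n)) c p)
        (mfderiv (𝓡 n) (𝓡 n) (chartAt (EuclideanSpace ℝ (Fin n)) c) p x)
        (mfderiv (𝓡 n) (𝓡 n) (chartAt (EuclideanSpace ℝ (Fin n)) c) p y) := rfl

theorem hessianMatrix_eq (f : M → V) (c : M) {u : EuclideanSpace ℝ (Fin n)}
    (hu : u ∈ (chartAt (EuclideanSpace ℝ (Fin n)) c).target) (l : V → ℝ) :
    (Matrix.of fun i j => l (chartHessian f c _ (coordVector c u i) (coordVector c u j))) =
      hessianMatrix (f ∘ (chartAt (EuclideanSpace ℝ (Fin n)) c).symm) u l := by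
  ext i j
  simp only [chartHessian_apply, Matrix.of_apply, hessianMatrix]
  rw [mfderiv_coordVector c hu, mfderiv_coordVector c hu,
    (chartAt (EuclideanSpace ℝ (Fin n)) c).right_inv hu]

namespace TransversalBundle

theorem lipschitzKilling_ne_zero (hf : ContMDiff (𝓡 n) 𝓘(ℝ, V) ∞ f) (N : TransversalBundle n f k)
    (E : EquiaffineStructure n M) (Ω : V [⋀^Fin (n + k + 1)]→ₗ[ℝ] ℝ) (c : M)
    {u : EuclideanSpace ℝ (Fin n)} (hu : u ∈ (chartAt (EuclideanSpace ℝ (Fin n)) c).target)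
    {a : Fin (k + 1) → ℝ} (h : N.lipschitzKilling E Ω ((chartAt (EuclideanSpace ℝ (Fin n)) c).symm u)
      (N.coord _ a) ≠ 0) :
    (hessianMatrix (f ∘ (chartAt (EuclideanSpace ℝ (Fin n)) c).symm) u
      (N.coordHeight E Ω ((chartAt (EuclideanSpace ℝ (Fin n)) c).symm u) a)).det ≠ 0 := by
  intro h0
  rw [N.lipschitzKilling_coord E Ω _ (E.vol_coordVector_ne_zero c hu) (chartHessian f c _)
    (fun l hl x y => conormal_fundamentalForm hf N c
      ((chartAt (EuclideanSpace ℝ (Fin n)) c).map_target hu) x y hl),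
    hessianMatrix_eq f c hu, h0] at h
  simp at h

variable [FiniteDimensional ℝ V] {Ω : V [⋀^Fin (n + k + 1)]→ₗ[ℝ] ℝ}

/-- The integral of `|G|` over the fibre, in terms of the Jacobian of the Gauss map in a chart. -/
theorem fibreIntegral_chart {N : TransversalBundle n f k} {E : EquiaffineStructure n M}
    (hV : Module.finrank ℝ V = n + k + 1) (hf : ContMDiff (𝓡 n) 𝓘(ℝ, V) ∞ f)
    (hN : N.Induces Ω E) (S : UnitEllipsoid Ω) {w : Fin (n + k + 1) → V} (hw : Ω w = 1)
    (hS : ∀ φ, S.sq φ = ∑ l, height Ω φ (w l) ^ 2) (c : M)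
    {W : Set (EuclideanSpace ℝ (Fin n))} (hW : IsOpen W)
    (hWt : W ⊆ (chartAt (EuclideanSpace ℝ (Fin n)) c).target)
    {ξ : Fin (k + 1) → EuclideanSpace ℝ (Fin n) → V} (hξ : ∀ j, ContDiffOn ℝ ∞ (ξ j) W)
    (hξN : ∀ u ∈ W, LinearIndependent ℝ (fun j => ξ j u) ∧
      ∀ j, ξ j u ∈ N.fibre ((chartAt (EuclideanSpace ℝ (Fin n)) c).symm u))
    (hΩ : ∀ u ∈ W,
      Ω (adaptedFrame (f ∘ (chartAt (EuclideanSpace ℝ (Fin n)) c).symm) ξ u) ≠ 0)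
    {u : EuclideanSpace ℝ (Fin n)} (hu : u ∈ W) :
    ‖E.vol _ (coordVector c u)‖ₑ *
        N.fibreIntegral E S ((chartAt (EuclideanSpace ℝ (Fin n)) c).symm u) =
      ((n + k + 1 : ℕ) : ℝ≥0∞) * ∫⁻ b in {b |
          0 < modelSq (conormalMap (f ∘ (chartAt (EuclideanSpace ℝ (Fin n)) c).symm) ξ w (u, b)) ∧
          modelSq (conormalMap (f ∘ (chartAt (EuclideanSpace ℝ (Fin n)) c).symm) ξ w (u, b)) < 1},
        ‖(fderiv ℝ (conormalMap (f ∘ (chartAt (EuclideanSpace ℝ (Fin n)) c).symm) ξ w)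
          (u, b)).det‖ₑ := by
  set e := chartAt (EuclideanSpace ℝ (Fin n)) c with he
  set g := f ∘ e.symm with hg
  have hgW : ContDiffOn ℝ ∞ g W := by
    have := contDiffOn_comp_chart_symm (hf.contMDiffOn (s := Set.univ)) c
    exact this.mono fun u hu => ⟨hWt hu, trivial⟩
  let L : (Fin (k + 1) → ℝ) →ₗ[ℝ] V →ₗ[ℝ] ℝ :=
    { toFun := fun b => (conormal g ξ (u, b)).toLinearMap
      map_add' := fun b b' => by ext; simp [conormal]
      map_smul' := fun t b => by ext; simp [conormal] }
  let ξ' : Fin (k + 1) → N.fibre (e.symm u) := fun j => ⟨ξ j u, (hξN u hu).2 j⟩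
  have hξ' : N.vol _ ξ' ≠ 0 := by
    refine map_ne_zero_of_linearIndependent (N.finrank_fibre _) (N.vol_ne_zero _) ?_
    exact LinearIndependent.of_comp (N.fibre (e.symm u)).subtype (hξN u hu).1
  have hmain := fibreIntegral_eq hN S hS (e.symm u) (E.vol_coordVector_ne_zero c (hWt hu))
    (chartHessian f c _)
    (fun l hl x y => conormal_fundamentalForm hf N c (e.map_target (hWt hu)) x y hl) hξ' L
    (fun b => (df_eq_zero_iff hf c (hWt hu) _).2 fun x => conormal_fderiv hV (hΩ u hu) x)
    (fun b j => conormal_normal hV (z := (u, b)) (hΩ u hu) j)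
  rw [hmain]
  congr 1
  have hset : {b | 0 < modelSq (conormalMap g ξ w (u, b)) ∧
      modelSq (conormalMap g ξ w (u, b)) < 1} =
        {b | 0 < ∑ l, L b (w l) ^ 2 ∧ ∑ l, L b (w l) ^ 2 < 1} := by
    ext b
    simp only [conormalMap, modelSq_evalFrame]
    rfl
  rw [hset]
  refine lintegral_congr fun b => ?_
  rw [hessianMatrix_eq f c (hWt hu) (L b)]
  have h1 := abs_det_fderiv_conormalMap hV hW hgW hξ hΩ hw (z := (u, b)) hu
  rw [Real.enorm_eq_ofReal_abs, Real.enorm_eq_ofReal_abs, h1]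
  congr 3
  refine congrArg Ω ?_
  rw [adaptedFrame]
  congr 1
  funext i
  exact df_chart_symm hf c (hWt hu) _

end TransversalBundle

end ChartIntegral

/-! ### The volume measure in a chart -/

section ChartMeasure

open MeasureTheory

theorem measurableSet_target_inter_preimage {X Y : Type*} [TopologicalSpace X] [TopologicalSpace Y]
    [MeasurableSpace X] [BorelSpace X] [MeasurableSpace Y] [BorelSpace Y]
    (e : OpenPartialHomeomorph Y X) {A : Set Y} (hA : MeasurableSet A) :
    MeasurableSet (e.target ∩ e.symm ⁻¹' A) := by
  let r : e.target → Y := fun u => e.symm u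
  have hr : Measurable r := e.symm.isOpenEmbedding_restrict.continuous.measurable
  have h1 : e.target ∩ e.symm ⁻¹' A = Subtype.val '' (r ⁻¹' A) := by
    ext u
    simp [r, and_comm]
  rw [h1]
  exact (MeasurableEmbedding.subtype_coe e.open_target.measurableSet).measurableSet_image.2 (hr hA)

/-- Change of variables by the inverse of a partial homeomorphism; no measurability of the integrand
is needed, since the restriction of the inverse to the target is a measurable embedding. -/
theorem setLIntegral_map_symm {X Y : Type*} [TopologicalSpace X] [TopologicalSpace Y]
    [MeasurableSpace X] [BorelSpace X] [MeasurableSpace Y] [BorelSpace Y]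
    (e : OpenPartialHomeomorph Y X) (ν : Measure X) {A : Set Y} (hA : MeasurableSet A)
    (I : Y → ℝ≥0∞) :
    ∫⁻ p in A, I p ∂((ν.restrict e.target).map e.symm) =
      ∫⁻ u in e.target ∩ e.symm ⁻¹' A, I (e.symm u) ∂ν := by
  have ht : MeasurableSet e.target := e.open_target.measurableSet
  let r : e.target → Y := fun u => e.symm u
  have hemb : MeasurableEmbedding r := e.symm.isOpenEmbedding_restrict.measurableEmbedding
  have hpre : MeasurableSet (e.target ∩ e.symm ⁻¹' A) := measurableSet_target_inter_preimage e hA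
  have hmap : (ν.restrict e.target).map e.symm =
      (ν.comap (Subtype.val : e.target → X)).map r := by
    rw [← map_comap_subtype_coe ht ν, AEMeasurable.map_map_of_aemeasurable]
    · rfl
    · rw [map_comap_subtype_coe ht ν]
      exact e.continuousOn_symm.aemeasurable ht
    · exact measurable_subtype_coe.aemeasurable
  rw [hmap, ← lintegral_indicator hA, hemb.lintegral_map]
  change ∫⁻ u : e.target, (A.indicator I ∘ e.symm) u ∂_ = _
  rw [lintegral_subtype_comap ht (A.indicator I ∘ e.symm)]
  have h2 : ∫⁻ u in e.target, (A.indicator I ∘ e.symm) u ∂ν =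
      ∫⁻ u in e.target, (e.target ∩ e.symm ⁻¹' A).indicator (I ∘ e.symm) u ∂ν := by
    refine setLIntegral_congr_fun ht fun u hu => ?_
    by_cases h : e.symm u ∈ A
    · simp [h, hu]
    · simp [h]
  rw [h2, lintegral_indicator hpre, Measure.restrict_restrict hpre,
    Set.inter_eq_left.2 Set.inter_subset_left]
  rfl

variable {n : ℕ} {M : Type*} [TopologicalSpace M] [ChartedSpace (EuclideanSpace ℝ (Fin n)) M]
  [IsManifold (𝓡 n) ∞ M] [T2Space M] [MeasurableSpace M] [BorelSpace M]

theorem EquiaffineStructure.setLIntegral_chartVolume (E : EquiaffineStructure n M) (c : M)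
    {A : Set M} (hA : MeasurableSet A) (I : M → ℝ≥0∞) :
    ∫⁻ p in A, I p ∂chartVolume E.vol c =
      ∫⁻ u in (chartAt (EuclideanSpace ℝ (Fin n)) c).target ∩
          (chartAt (EuclideanSpace ℝ (Fin n)) c).symm ⁻¹' A,
        ‖E.vol _ (coordVector c u)‖ₑ * I ((chartAt (EuclideanSpace ℝ (Fin n)) c).symm u) := by
  set e := chartAt (EuclideanSpace ℝ (Fin n)) c with he
  have hB := measurableSet_target_inter_preimage e hA
  have hd : AEMeasurable (fun u => ‖E.vol (e.symm u) (coordVector c u)‖ₑ)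
      (volume.restrict (e.target ∩ e.symm ⁻¹' A)) :=
    (((E.continuousOn_density c).aemeasurable e.open_target.measurableSet).mono_measure
      (Measure.restrict_mono Set.inter_subset_left le_rfl)).enorm
  have h1 : chartVolume E.vol c = ((volume.withDensity
      fun u => ‖E.vol (e.symm u) (coordVector c u)‖ₑ).restrict e.target).map e.symm := by
    rw [restrict_withDensity e.open_target.measurableSet]
    rfl
  rw [h1, setLIntegral_map_symm e _ hA, restrict_withDensity hB,
    lintegral_withDensity_eq_lintegral_mul_non_measurable₀ _ hd
      (Filter.Eventually.of_forall fun u => enorm_lt_top)]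
  rfl

theorem chartVolume_le_volumeMeasure (θ : Π p : M, (TangentSpace (𝓡 n) p) [⋀^Fin n]→ₗ[ℝ] ℝ)
    (c : M) : chartVolume θ c ≤ volumeMeasure θ :=
  le_iSup (fun c => chartVolume θ c) c

end ChartMeasure

/-! ### Adapted charts and the area inequality -/

section GaussMap

open MeasureTheory

variable {n : ℕ} {M : Type*} [TopologicalSpace M] [ChartedSpace (EuclideanSpace ℝ (Fin n)) M]
  [IsManifold (𝓡 n) ∞ M] {V : Type*} [NormedAddCommGroup V] [NormedSpace ℝ V] {k : ℕ} {f : M → V}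

/-- A neighbourhood of `c` inside the domain of the chart around `c`, with a frame of the
transversal bundle on it. -/
structure AdaptedChart (N : TransversalBundle n f k) (c : M) where
  nbhd : Set M
  isOpen_nbhd : IsOpen nbhd
  mem_nbhd : c ∈ nbhd
  nbhd_subset : nbhd ⊆ (chartAt (EuclideanSpace ℝ (Fin n)) c).source
  normal : Fin (k + 1) → M → V
  contMDiffOn_normal : ∀ j, ContMDiffOn (𝓡 n) 𝓘(ℝ, V) ∞ (normal j) nbhd
  linearIndependent_normal : ∀ q ∈ nbhd, LinearIndependent ℝ fun j => normal j q
  normal_mem : ∀ q ∈ nbhd, ∀ j, normal j q ∈ N.fibre q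

theorem TransversalBundle.nonempty_adaptedChart (N : TransversalBundle n f k) (c : M) :
    Nonempty (AdaptedChart N c) := by
  obtain ⟨U, hU, hc, ξ, hξ, h⟩ := N.exists_frame c
  refine ⟨⟨U ∩ (chartAt (EuclideanSpace ℝ (Fin n)) c).source,
    hU.inter (chartAt (EuclideanSpace ℝ (Fin n)) c).open_source, ⟨hc, mem_chart_source _ c⟩,
    Set.inter_subset_right, ξ, fun j => (hξ j).mono Set.inter_subset_left,
    fun q hq => (h q hq.1).1, fun q hq j => ?_⟩⟩
  rw [← (h q hq.1).2]
  exact Submodule.subset_span ⟨j, rfl⟩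

instance isAddHaarMeasure_volume_conormalModel (n k : ℕ) :
    (volume : Measure (ConormalModel n k)).IsAddHaarMeasure :=
  Measure.prod.instIsAddHaarMeasure volume volume

namespace AdaptedChart

variable {N : TransversalBundle n f k} {c : M} (D : AdaptedChart N c)

/-- The coordinates of the points of `A` in the chart around `c`. -/
def coordSet (_ : AdaptedChart N c) (A : Set M) : Set (EuclideanSpace ℝ (Fin n)) :=
  (chartAt (EuclideanSpace ℝ (Fin n)) c).target ∩
    (chartAt (EuclideanSpace ℝ (Fin n)) c).symm ⁻¹' A

/-- The immersion in the chart. -/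
def immersion (_ : AdaptedChart N c) : EuclideanSpace ℝ (Fin n) → V :=
  f ∘ (chartAt (EuclideanSpace ℝ (Fin n)) c).symm

/-- The frame of the transversal bundle in the chart. -/
def frame (j : Fin (k + 1)) : EuclideanSpace ℝ (Fin n) → V :=
  D.normal j ∘ (chartAt (EuclideanSpace ℝ (Fin n)) c).symm

/-- The conormal functional with parameters `z`. -/
def functional (z : ConormalModel n k) : V →L[ℝ] ℝ := conormal D.immersion D.frame z

/-- The Gauss map of the conormal bundle in the chart. -/
def gaussMap (w : Fin (n + k + 1) → V) : ConormalModel n k → ConormalModel n k :=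
  conormalMap D.immersion D.frame w

theorem gaussMap_eq (w : Fin (n + k + 1) → V) (z : ConormalModel n k) :
    D.gaussMap w z = evalFrame w (D.functional z) := rfl

/-- The conormal functionals at the points of `A` that lie in the punctured open unit ball. -/
def ballBundle (w : Fin (n + k + 1) → V) (A : Set M) : Set (ConormalModel n k) :=
  {z | z.1 ∈ D.coordSet A ∧ 0 < modelSq (D.gaussMap w z) ∧ modelSq (D.gaussMap w z) < 1}

/-- The conormal functionals `l` over the chart for which `s • l ∘ f` attains its maximum at the
base point. -/
def extremeSet (s : ℝ) : Set (ConormalModel n k) :=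
  {z | ∀ q, s * D.functional z (f q) ≤ s * D.functional z (D.immersion z.1)}

theorem isOpen_coordSet {A : Set M} (hA : IsOpen A) : IsOpen (D.coordSet A) :=
  (chartAt (EuclideanSpace ℝ (Fin n)) c).symm.isOpen_inter_preimage hA

theorem coordSet_mono {A B : Set M} (h : A ⊆ B) : D.coordSet A ⊆ D.coordSet B :=
  Set.inter_subset_inter_right _ (Set.preimage_mono h)

theorem contDiffOn_immersion (hf : ContMDiff (𝓡 n) 𝓘(ℝ, V) ∞ f) :
    ContDiffOn ℝ ∞ D.immersion (D.coordSet D.nbhd) :=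
  (contDiffOn_comp_chart_symm (hf.contMDiffOn (s := Set.univ)) c).mono fun _ hu => ⟨hu.1, trivial⟩

theorem contDiffOn_frame (j : Fin (k + 1)) : ContDiffOn ℝ ∞ (D.frame j) (D.coordSet D.nbhd) :=
  contDiffOn_comp_chart_symm (D.contMDiffOn_normal j) c

variable [FiniteDimensional ℝ V] {Ω : V [⋀^Fin (n + k + 1)]→ₗ[ℝ] ℝ} {E : EquiaffineStructure n M}
  {w : Fin (n + k + 1) → V}

theorem map_adaptedFrame_ne_zero (hf : ContMDiff (𝓡 n) 𝓘(ℝ, V) ∞ f) (hN : N.Induces Ω E)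
    {u : EuclideanSpace ℝ (Fin n)} (hu : u ∈ D.coordSet D.nbhd) :
    Ω (adaptedFrame D.immersion D.frame u) ≠ 0 := by
  set e := chartAt (EuclideanSpace ℝ (Fin n)) c
  let ξ' : Fin (k + 1) → N.fibre (e.symm u) := fun j => ⟨D.frame j u, D.normal_mem _ hu.2 j⟩
  have hξ' : N.vol _ ξ' ≠ 0 := by
    refine map_ne_zero_of_linearIndependent (N.finrank_fibre _) (N.vol_ne_zero _) ?_
    exact LinearIndependent.of_comp (N.fibre (e.symm u)).subtype
      (D.linearIndependent_normal _ hu.2)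
  have h := N.append_eq_mul hN (e.symm u) (coordVector c u) ξ'
  have h2 : adaptedFrame D.immersion D.frame u = Fin.append (n := k + 1)
      (fun i => df n f (e.symm u) (coordVector c u i)) fun j => (ξ' j : V) := by
    rw [adaptedFrame]
    congr 1
    funext i
    exact (df_chart_symm hf c hu.1 _).symm
  rw [h2, h]
  exact mul_ne_zero (E.vol_coordVector_ne_zero c hu.1) hξ'

variable [T2Space M] [MeasurableSpace M] [BorelSpace M]

theorem continuousOn_functional (hV : Module.finrank ℝ V = n + k + 1)
    (hf : ContMDiff (𝓡 n) 𝓘(ℝ, V) ∞ f) (hN : N.Induces Ω E) :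
    ContinuousOn D.functional (D.coordSet D.nbhd ×ˢ Set.univ) :=
  (contDiffOn_conormal hV (D.isOpen_coordSet D.isOpen_nbhd) (D.contDiffOn_immersion hf)
    D.contDiffOn_frame fun _ => D.map_adaptedFrame_ne_zero hf hN).continuousOn

theorem contDiffOn_gaussMap (hV : Module.finrank ℝ V = n + k + 1)
    (hf : ContMDiff (𝓡 n) 𝓘(ℝ, V) ∞ f) (hN : N.Induces Ω E) :
    ContDiffOn ℝ ∞ (D.gaussMap w) (D.coordSet D.nbhd ×ˢ Set.univ) :=
  contDiffOn_conormalMap hV (D.isOpen_coordSet D.isOpen_nbhd) (D.contDiffOn_immersion hf)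
    D.contDiffOn_frame fun _ => D.map_adaptedFrame_ne_zero hf hN

theorem isOpen_prod : IsOpen (D.coordSet D.nbhd ×ˢ (Set.univ : Set (Fin (k + 1) → ℝ))) :=
  (D.isOpen_coordSet D.isOpen_nbhd).prod isOpen_univ

theorem continuous_modelSq : Continuous (modelSq (n := n) (k := k)) := by
  unfold modelSq
  fun_prop

theorem isOpen_ballBundle (hV : Module.finrank ℝ V = n + k + 1)
    (hf : ContMDiff (𝓡 n) 𝓘(ℝ, V) ∞ f) (hN : N.Induces Ω E) :
    IsOpen (D.ballBundle w D.nbhd) := by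
  have h := (continuous_modelSq.comp_continuousOn
    (D.contDiffOn_gaussMap (w := w) hV hf hN).continuousOn).isOpen_inter_preimage
    D.isOpen_prod (isOpen_Ioo (a := (0 : ℝ)) (b := 1))
  have h2 : D.ballBundle w D.nbhd = (D.coordSet D.nbhd ×ˢ Set.univ) ∩
      (modelSq ∘ D.gaussMap w) ⁻¹' Set.Ioo 0 1 := by
    ext z
    simp [ballBundle]
  exact h2 ▸ h

theorem ballBundle_eq {A : Set M} (hA : A ⊆ D.nbhd) : D.ballBundle w A =
    D.ballBundle w D.nbhd ∩ Prod.fst ⁻¹' D.coordSet A := by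
  ext z
  simp only [ballBundle, Set.mem_inter_iff, Set.mem_ofPred_eq, Set.mem_preimage]
  exact ⟨fun h => ⟨⟨D.coordSet_mono hA h.1, h.2⟩, h.1⟩, fun h => ⟨h.2, h.1.2⟩⟩

theorem ballBundle_subset {A : Set M} (hA : A ⊆ D.nbhd) :
    D.ballBundle w A ⊆ D.coordSet D.nbhd ×ˢ Set.univ :=
  fun _ hz => ⟨D.coordSet_mono hA hz.1, trivial⟩

theorem measurableSet_ballBundle (hV : Module.finrank ℝ V = n + k + 1)
    (hf : ContMDiff (𝓡 n) 𝓘(ℝ, V) ∞ f) (hN : N.Induces Ω E) {A : Set M} (hA : MeasurableSet A)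
    (hAD : A ⊆ D.nbhd) : MeasurableSet (D.ballBundle w A) := by
  rw [D.ballBundle_eq hAD]
  exact (D.isOpen_ballBundle hV hf hN).measurableSet.inter
    (measurable_fst (measurableSet_target_inter_preimage _ hA))

theorem isOpen_diff_extremeSet (hV : Module.finrank ℝ V = n + k + 1)
    (hf : ContMDiff (𝓡 n) 𝓘(ℝ, V) ∞ f) (hN : N.Induces Ω E) (s : ℝ) :
    IsOpen ((D.coordSet D.nbhd ×ˢ Set.univ) \ D.extremeSet s) := by
  have h : (D.coordSet D.nbhd ×ˢ Set.univ) \ D.extremeSet s = ⋃ q,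
      (D.coordSet D.nbhd ×ˢ (Set.univ : Set (Fin (k + 1) → ℝ))) ∩
        (fun z => s * D.functional z (f q) - s * D.functional z (D.immersion z.1)) ⁻¹'
          Set.Ioi 0 := by
    ext z
    simp [extremeSet]
  rw [h]
  refine isOpen_iUnion fun q => ContinuousOn.isOpen_inter_preimage ?_ D.isOpen_prod isOpen_Ioi
  have h1 := D.continuousOn_functional hV hf hN
  have h2 : ContinuousOn (fun z : ConormalModel n k => D.immersion z.1)
      (D.coordSet D.nbhd ×ˢ Set.univ) :=
    (D.contDiffOn_immersion hf).continuousOn.comp continuousOn_fst fun z hz => hz.1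
  exact (continuousOn_const.mul (h1.clm_apply continuousOn_const)).sub
    (continuousOn_const.mul (h1.clm_apply h2))

theorem measurableSet_inter_extremeSet (hV : Module.finrank ℝ V = n + k + 1)
    (hf : ContMDiff (𝓡 n) 𝓘(ℝ, V) ∞ f) (hN : N.Induces Ω E) {A : Set M} (hA : MeasurableSet A)
    (hAD : A ⊆ D.nbhd) (s : ℝ) : MeasurableSet (D.ballBundle w A ∩ D.extremeSet s) := by
  have h : D.ballBundle w A ∩ D.extremeSet s =
      D.ballBundle w A \ ((D.coordSet D.nbhd ×ˢ Set.univ) \ D.extremeSet s) := by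
    ext z
    have h1 : z ∈ D.ballBundle w A → z ∈ D.coordSet D.nbhd ×ˢ Set.univ :=
      fun hz => D.ballBundle_subset hAD hz
    simp only [Set.mem_inter_iff, Set.mem_sdiff]
    tauto
  rw [h]
  exact (D.measurableSet_ballBundle hV hf hN hA hAD).diff
    (D.isOpen_diff_extremeSet hV hf hN s).measurableSet

/-- The area inequality for the Gauss map. -/
theorem volume_image_le (hV : Module.finrank ℝ V = n + k + 1)
    (hf : ContMDiff (𝓡 n) 𝓘(ℝ, V) ∞ f) (hN : N.Induces Ω E) {T : Set (ConormalModel n k)}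
    (hT : MeasurableSet T) (hTD : T ⊆ D.coordSet D.nbhd ×ˢ Set.univ) :
    volume (D.gaussMap w '' T) ≤ ∫⁻ z in T, ‖(fderiv ℝ (D.gaussMap w) z).det‖ₑ := by
  have h := addHaar_image_le_lintegral_abs_det_fderiv (μ := (volume : Measure (ConormalModel n k)))
    (f := D.gaussMap w) (f' := fderiv ℝ (D.gaussMap w)) hT (fun z hz => by
    have h1 := (D.contDiffOn_gaussMap (w := w) hV hf hN).contDiffAt
      (D.isOpen_prod.mem_nhds (hTD hz))
    exact (h1.differentiableAt (by simp)).hasFDerivAt.hasFDerivWithinAt)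
  simpa only [← Real.enorm_eq_ofReal_abs] using h

/-- The integral of the Jacobian of the Gauss map bounds the contribution of `A` to the total
absolute curvature from below. -/
theorem lintegral_det_le (hV : Module.finrank ℝ V = n + k + 1)
    (hf : ContMDiff (𝓡 n) 𝓘(ℝ, V) ∞ f) (hN : N.Induces Ω E) (S : UnitEllipsoid Ω)
    (hw : Ω w = 1) (hS : ∀ φ, S.sq φ = ∑ l, height Ω φ (w l) ^ 2)
    {A : Set M} (hA : MeasurableSet A) (hAD : A ⊆ D.nbhd) :
    ((n + k + 1 : ℕ) : ℝ≥0∞) *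
        ∫⁻ z in D.ballBundle w A, ‖(fderiv ℝ (D.gaussMap w) z).det‖ₑ ≤
      ∫⁻ p in A, N.fibreIntegral E S p ∂volumeMeasure E.vol := by
  have hA' : MeasurableSet (D.coordSet A) := measurableSet_target_inter_preimage _ hA
  have hO := D.measurableSet_ballBundle (w := w) hV hf hN hA hAD
  have hW := D.isOpen_coordSet D.isOpen_nbhd
  refine le_trans ?_ (lintegral_mono' (Measure.restrict_mono le_rfl
    (chartVolume_le_volumeMeasure E.vol c)) le_rfl)
  rw [E.setLIntegral_chartVolume c hA]
  have h1 : ∫⁻ u in D.coordSet A, ‖E.vol _ (coordVector c u)‖ₑ *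
        N.fibreIntegral E S ((chartAt (EuclideanSpace ℝ (Fin n)) c).symm u) =
      ∫⁻ u in D.coordSet A, ((n + k + 1 : ℕ) : ℝ≥0∞) * ∫⁻ b in {b |
          0 < modelSq (D.gaussMap w (u, b)) ∧ modelSq (D.gaussMap w (u, b)) < 1},
        ‖(fderiv ℝ (D.gaussMap w) (u, b)).det‖ₑ := by
    refine setLIntegral_congr_fun hA' fun u hu => ?_
    exact N.fibreIntegral_chart hV hf hN S hw hS c hW Set.inter_subset_left
      D.contDiffOn_frame (fun u hu => ⟨D.linearIndependent_normal _ hu.2, D.normal_mem _ hu.2⟩)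
      (fun u hu => D.map_adaptedFrame_ne_zero hf hN hu) (D.coordSet_mono hAD hu)
  refine le_of_le_of_eq ?_ h1.symm
  rw [lintegral_const_mul' _ _ (ENNReal.natCast_ne_top _)]
  refine mul_le_mul_right ?_ _
  rw [← lintegral_indicator hO, ← lintegral_indicator hA', Measure.volume_eq_prod]
  refine (lintegral_prod_le _).trans (lintegral_mono fun u => ?_)
  by_cases hu : u ∈ D.coordSet A
  · rw [Set.indicator_of_mem hu]
    refine le_trans (lintegral_mono fun b => ?_) (lintegral_indicator_le _ _)
    by_cases hb : (u, b) ∈ D.ballBundle w A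
    · rw [Set.indicator_of_mem hb, Set.indicator_of_mem (by exact hb.2)]
    · simp [hb]
  · rw [Set.indicator_of_notMem hu]
    simp [ballBundle, hu]

end AdaptedChart

end GaussMap

/-! ### The unit ball, frames and extrema -/

section UnitBall

open MeasureTheory

theorem volume_modelSq_lt_one (n k : ℕ) :
    volume {y : ConormalModel n k | 0 < modelSq y ∧ modelSq y < 1} =
      volume (Metric.ball (0 : EuclideanSpace ℝ (Fin (n + k + 1))) 1) := by
  let ψ : ConormalModel n k → EuclideanSpace ℝ (Fin (n + k + 1)) := fun y =>
    WithLp.toLp 2 (MeasurableEquiv.piCongrLeft (fun _ => ℝ) (frameIndex n k)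
      ((MeasurableEquiv.sumPiEquivProdPi fun _ : Fin n ⊕ Fin (k + 1) => ℝ).symm
        (WithLp.ofLp y.1, y.2)))
  have hψ : MeasurePreserving ψ volume volume :=
    (PiLp.volume_preserving_toLp (Fin (n + k + 1))).comp
      ((volume_measurePreserving_piCongrLeft (fun _ => ℝ) (frameIndex n k)).comp
        ((volume_measurePreserving_sumPiEquivProdPi_symm
          fun _ : Fin n ⊕ Fin (k + 1) => ℝ).comp
          ((PiLp.volume_preserving_ofLp (Fin n)).prod (MeasurePreserving.id volume))))
  have hsq (y : ConormalModel n k) : modelSq y = ‖ψ y‖ ^ 2 := by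
    rw [EuclideanSpace.real_norm_sq_eq, ← (frameIndex n k).sum_comp, Fintype.sum_sum_type]
    simp only [ψ, modelSq]
    congr 1
    · refine Finset.sum_congr rfl fun i _ => ?_
      exact congrArg (· ^ 2) (Equiv.piCongrLeft_apply_apply (fun _ => ℝ) (frameIndex n k)
        ((MeasurableEquiv.sumPiEquivProdPi fun _ : Fin n ⊕ Fin (k + 1) => ℝ).symm
          (WithLp.ofLp y.1, y.2)) (Sum.inl i)).symm
    · refine Finset.sum_congr rfl fun i _ => ?_
      exact congrArg (· ^ 2) (Equiv.piCongrLeft_apply_apply (fun _ => ℝ) (frameIndex n k)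
        ((MeasurableEquiv.sumPiEquivProdPi fun _ : Fin n ⊕ Fin (k + 1) => ℝ).symm
          (WithLp.ofLp y.1, y.2)) (Sum.inr i)).symm
  have hset : {y : ConormalModel n k | 0 < modelSq y ∧ modelSq y < 1} =
      ψ ⁻¹' (Metric.ball 0 1 \ {0}) := by
    ext y
    have h0 : 0 < ‖ψ y‖ ^ 2 ↔ ψ y ≠ 0 := by
      rw [← norm_ne_zero_iff, sq_pos_iff]
    have h1 : ‖ψ y‖ ^ 2 < 1 ↔ ‖ψ y‖ < 1 := sq_lt_one_iff₀ (norm_nonneg _)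
    rw [Set.mem_ofPred_eq, hsq, h0, h1, Set.mem_preimage, Set.mem_sdiff, mem_ball_zero_iff,
      Set.mem_singleton_iff]
    exact and_comm
  rw [hset, hψ.measure_preimage
    (Metric.isOpen_ball.measurableSet.diff (measurableSet_singleton 0)).nullMeasurableSet,
    measure_sdiff_null (measure_singleton 0)]

end UnitBall

section Frames

variable {n k : ℕ} {V : Type*} [NormedAddCommGroup V] [NormedSpace ℝ V] [FiniteDimensional ℝ V]
  {Ω : V [⋀^Fin (n + k + 1)]→ₗ[ℝ] ℝ} {w : Fin (n + k + 1) → V}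

theorem evalFrame_injective (hV : Module.finrank ℝ V = n + k + 1) (hw : Ω w ≠ 0) :
    Function.Injective (evalFrame w) := by
  let b := basisOfLinearIndependentOfCardEqFinrank (linearIndependent_of_map_ne_zero Ω hw)
    (by simp [hV])
  have hb : ⇑b = w := coe_basisOfLinearIndependentOfCardEqFinrank _ _
  intro l l' h
  refine ContinuousLinearMap.coe_injective (b.ext fun i => ?_)
  have h1 := modelBasis_repr_evalFrame w l ((frameIndex n k).symm i)
  have h2 := modelBasis_repr_evalFrame w l' ((frameIndex n k).symm i)
  rw [h, h2, Equiv.apply_symm_apply] at h1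
  simpa [hb] using h1.symm

theorem evalFrame_surjective (hV : Module.finrank ℝ V = n + k + 1) (hw : Ω w ≠ 0) :
    Function.Surjective (evalFrame w) := by
  let b := basisOfLinearIndependentOfCardEqFinrank (linearIndependent_of_map_ne_zero Ω hw)
    (by simp [hV])
  have hb : ⇑b = w := coe_basisOfLinearIndependentOfCardEqFinrank _ _
  intro y
  refine ⟨LinearMap.toContinuousLinearMap (b.constr ℝ fun i =>
    (modelBasis n k).repr y ((frameIndex n k).symm i)), ?_⟩
  refine (modelBasis n k).repr.injective (Finsupp.ext fun i => ?_)
  rw [modelBasis_repr_evalFrame, ← hb]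
  simp [b.constr_basis]

open MeasureTheory in
/-- The functionals that vanish at a given non-zero vector form a null set. -/
theorem volume_evalFrame_ker (hV : Module.finrank ℝ V = n + k + 1) (hw : Ω w ≠ 0) {v : V}
    (hv : v ≠ 0) : volume (evalFrame w '' {l | l v = 0}) = 0 := by
  let K : Submodule ℝ (V →L[ℝ] ℝ) := (ContinuousLinearMap.apply ℝ ℝ v).ker
  have hK : evalFrame w '' {l | l v = 0} = (K.map (evalFrame w).toLinearMap : Set _) := by
    ext y
    simp [K]
  rw [hK]
  refine Measure.addHaar_submodule _ _ fun htop => ?_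
  obtain ⟨l, -, hl⟩ := exists_dual_vector ℝ v (norm_ne_zero_iff.2 hv)
  replace hl : l v ≠ 0 := by simpa [hl] using hv
  have h1 : evalFrame w l ∈ K.map (evalFrame w).toLinearMap := htop ▸ Submodule.mem_top
  obtain ⟨l', hl', h2⟩ := h1
  rw [← evalFrame_injective hV hw h2] at hl
  exact hl hl'

end Frames

section Extrema

open MeasureTheory

variable {n : ℕ} {M : Type*} [TopologicalSpace M] [ChartedSpace (EuclideanSpace ℝ (Fin n)) M]
  [IsManifold (𝓡 n) ∞ M] {V : Type*} [NormedAddCommGroup V] [NormedSpace ℝ V] {k : ℕ} {f : M → V}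

/-- At an extremum of `l ∘ f` the functional `l` is conormal; `s` carries the sign that
distinguishes maxima from minima. -/
theorem apply_df_eq_zero_of_extremum (hf : ContMDiff (𝓡 n) 𝓘(ℝ, V) ∞ f) {l : V →L[ℝ] ℝ} {s : ℝ}
    (hs : s ≠ 0) {p : M} (hp : ∀ q, s * l (f q) ≤ s * l (f p)) (x : TangentSpace (𝓡 n) p) :
    l (df n f p x) = 0 := by
  set e := chartAt (EuclideanSpace ℝ (Fin n)) p with he
  have hps : p ∈ e.source := mem_chart_source _ p
  rw [df_eq_fderiv hf p hps, ← he]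
  set y : EuclideanSpace ℝ (Fin n) := mfderiv (𝓡 n) (𝓡 n) e p x
  have hg : ContDiffOn ℝ ∞ (f ∘ e.symm) e.target := by
    simpa using contDiffOn_comp_chart_symm (hf.contMDiffOn (s := Set.univ)) p
  have hd : HasFDerivAt (f ∘ e.symm) (fderiv ℝ (f ∘ e.symm) (e p)) (e p) :=
    ((hg.contDiffAt (e.open_target.mem_nhds (e.map_source hps))).differentiableAt
      (by simp)).hasFDerivAt
  have h1 : HasFDerivAt (fun u => s * l ((f ∘ e.symm) u))
      (s • (l ∘L fderiv ℝ (f ∘ e.symm) (e p))) (e p) :=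
    (l.hasFDerivAt.comp (e p) hd).const_mul s
  have h2 : IsLocalMax (fun u => s * l ((f ∘ e.symm) u)) (e p) :=
    Filter.Eventually.of_forall fun u => by
      simpa [e.left_inv hps] using hp (e.symm u)
  have h3 := congrArg (fun φ => φ y) (h2.hasFDerivAt_eq_zero h1)
  simpa [hs] using h3

variable [FiniteDimensional ℝ V] {Ω : V [⋀^Fin (n + k + 1)]→ₗ[ℝ] ℝ} {E : EquiaffineStructure n M}
  {w : Fin (n + k + 1) → V} {N : TransversalBundle n f k}

/-- Every conormal functional at a point of an adapted chart is parametrized by the chart. -/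
theorem AdaptedChart.functional_eq (hV : Module.finrank ℝ V = n + k + 1)
    (hf : ContMDiff (𝓡 n) 𝓘(ℝ, V) ∞ f) (hN : N.Induces Ω E) {c : M} (D : AdaptedChart N c) {p : M}
    (hp : p ∈ D.nbhd) {l : V →L[ℝ] ℝ} (hl : ∀ x, l (df n f p x) = 0) :
    D.functional (chartAt (EuclideanSpace ℝ (Fin n)) c p,
      fun j => l (D.frame j (chartAt (EuclideanSpace ℝ (Fin n)) c p))) = l := by
  set e := chartAt (EuclideanSpace ℝ (Fin n)) c with he
  have hps := D.nbhd_subset hp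
  have hu : e p ∈ D.coordSet D.nbhd := ⟨e.map_source hps, by
    rw [Set.mem_preimage, ← he, e.left_inv hps]
    exact hp⟩
  refine conormal_eq hV (D.map_adaptedFrame_ne_zero hf hN hu) ?_
  refine (df_eq_zero_iff hf c hu.1 l.toLinearMap).1 ?_
  have h4 : ∀ q, q = p → ∀ y, l (df n f q y) = 0 := by
    rintro q rfl
    exact hl
  exact h4 _ (e.left_inv hps)

variable [T2Space M] [CompactSpace M]

/-- A continuous function on a compact manifold attains its extrema, which are critical points.
Hence every functional is the image of an extremal point of the conormal bundle. -/
theorem exists_mem_extremeSet [Nonempty M] (hV : Module.finrank ℝ V = n + k + 1)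
    (hf : ContMDiff (𝓡 n) 𝓘(ℝ, V) ∞ f) (hN : N.Induces Ω E) {x : ℕ → M}
    (D : ∀ i, AdaptedChart N (x i)) {A : ℕ → Set M} (hA : ∀ i, A i ⊆ (D i).nbhd)
    (hcover : ⋃ i, A i = Set.univ) {l : V →L[ℝ] ℝ} (hl0 : 0 < modelSq (evalFrame w l))
    (hl1 : modelSq (evalFrame w l) < 1) {s : ℝ} (hs : s ≠ 0) :
    ∃ i, ∃ z ∈ (D i).ballBundle w (A i) ∩ (D i).extremeSet s, (D i).functional z = l := by
  have hc : Continuous fun q => s * l (f q) :=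
    continuous_const.mul (l.continuous.comp hf.continuous)
  obtain ⟨p, -, hp⟩ := isCompact_univ.exists_isMaxOn Set.univ_nonempty hc.continuousOn
  replace hp : ∀ q, s * l (f q) ≤ s * l (f p) := fun q => hp (Set.mem_univ q)
  obtain ⟨i, hi⟩ := Set.mem_iUnion.1 (hcover ▸ Set.mem_univ p : p ∈ ⋃ i, A i)
  have hfun := (D i).functional_eq hV hf hN (hA i hi) (apply_df_eq_zero_of_extremum hf hs hp)
  have hps := (D i).nbhd_subset (hA i hi)
  refine ⟨i, _, ⟨⟨⟨(chartAt _ (x i)).map_source hps, ?_⟩, ?_, ?_⟩, ?_⟩, hfun⟩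
  · rw [Set.mem_preimage, (chartAt _ (x i)).left_inv hps]
    exact hi
  · rwa [(D i).gaussMap_eq, hfun]
  · rwa [(D i).gaussMap_eq, hfun]
  · intro q
    rw [hfun]
    have h1 : (D i).immersion (chartAt (EuclideanSpace ℝ (Fin n)) (x i) p) = f p :=
      congrArg f ((chartAt _ (x i)).left_inv hps)
    simpa only [h1] using hp q

end Extrema

/-! ### The lower bound for the total absolute curvature -/

section LowerBound

open MeasureTheory

variable {n : ℕ} {M : Type*} [TopologicalSpace M] [ChartedSpace (EuclideanSpace ℝ (Fin n)) M]
  [IsManifold (𝓡 n) ∞ M] {V : Type*} [NormedAddCommGroup V] [NormedSpace ℝ V] {k : ℕ} {f : M → V}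
  [FiniteDimensional ℝ V] {Ω : V [⋀^Fin (n + k + 1)]→ₗ[ℝ] ℝ} {E : EquiaffineStructure n M}
  {w : Fin (n + k + 1) → V} {N : TransversalBundle n f k}
  [T2Space M] [MeasurableSpace M] [BorelSpace M]

/-- The points of the conormal bundle that are not extremal and at which the Gauss map is a local
diffeomorphism form an open set. If there is one, they contribute to the integral of the Jacobian.
-/
theorem AdaptedChart.lintegral_pos {c : M} (D : AdaptedChart N c)
    (hV : Module.finrank ℝ V = n + k + 1) (hf : ContMDiff (𝓡 n) 𝓘(ℝ, V) ∞ f) (hN : N.Induces Ω E)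
    {z : ConormalModel n k} (hz : z ∈ D.ballBundle w D.nbhd) (h₁ : z ∉ D.extremeSet 1)
    (h₂ : z ∉ D.extremeSet (-1)) (hdet : (fderiv ℝ (D.gaussMap w) z).det ≠ 0) :
    0 < ∫⁻ z in (D.ballBundle w D.nbhd \ D.extremeSet 1) \ D.extremeSet (-1),
      ‖(fderiv ℝ (D.gaussMap w) z).det‖ₑ := by
  set P := D.coordSet D.nbhd ×ˢ (Set.univ : Set (Fin (k + 1) → ℝ))
  have hP : IsOpen P := D.isOpen_prod
  have hsub : D.ballBundle w D.nbhd ⊆ P := D.ballBundle_subset subset_rfl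
  have hJ : ContinuousOn (fun z => (fderiv ℝ (D.gaussMap w) z).det) P :=
    ContinuousLinearMap.continuous_det.comp_continuousOn
      ((D.contDiffOn_gaussMap hV hf hN).continuousOn_fderiv_of_isOpen hP (by simp))
  let T := (D.ballBundle w D.nbhd ∩ ((P \ D.extremeSet 1) ∩ (P \ D.extremeSet (-1)))) ∩
    (P ∩ (fun z => (fderiv ℝ (D.gaussMap w) z).det) ⁻¹' {0}ᶜ)
  have hT : IsOpen T := ((D.isOpen_ballBundle hV hf hN).inter
    ((D.isOpen_diff_extremeSet hV hf hN 1).inter (D.isOpen_diff_extremeSet hV hf hN (-1)))).inter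
    (hJ.isOpen_inter_preimage hP isOpen_compl_singleton)
  have hzT : z ∈ T := ⟨⟨hz, ⟨hsub hz, h₁⟩, ⟨hsub hz, h₂⟩⟩, hsub hz, hdet⟩
  refine lt_of_lt_of_le ?_ (lintegral_mono_set (s := T) fun y hy =>
    ⟨⟨hy.1.1, hy.1.2.1.2⟩, hy.1.2.2.2⟩)
  rw [pos_iff_ne_zero]
  intro h0
  have hm : AEMeasurable (fun z => ‖(fderiv ℝ (D.gaussMap w) z).det‖ₑ) (volume.restrict T) :=
    ((hJ.mono fun y hy => hy.2.1).aemeasurable hT.measurableSet).enorm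
  rw [lintegral_eq_zero_iff' hm, Filter.EventuallyEq, ae_restrict_iff' hT.measurableSet] at h0
  refine (hT.measure_pos volume ⟨z, hzT⟩).ne' (measure_mono_null ?_ (ae_iff.1 h0))
  intro y hy h
  exact hy.2.2 (by simpa using h hy)

/-- The conormal bundle is split into maxima, minima that are not maxima, and the rest. -/
theorem AdaptedChart.lintegral_eq_add {c : M} (D : AdaptedChart N c)
    (hV : Module.finrank ℝ V = n + k + 1) (hf : ContMDiff (𝓡 n) 𝓘(ℝ, V) ∞ f) (hN : N.Induces Ω E)
    {A : Set M} (hA : MeasurableSet A) (hAD : A ⊆ D.nbhd) (J : ConormalModel n k → ℝ≥0∞) :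
    ∫⁻ z in D.ballBundle w A, J z = (∫⁻ z in D.ballBundle w A ∩ D.extremeSet 1, J z) +
      ((∫⁻ z in (D.ballBundle w A ∩ D.extremeSet (-1)) \ D.extremeSet 1, J z) +
        ∫⁻ z in (D.ballBundle w A \ D.extremeSet 1) \ D.extremeSet (-1), J z) := by
  have h₁ := D.measurableSet_inter_extremeSet (w := w) hV hf hN hA hAD 1
  have h₂ := D.measurableSet_inter_extremeSet (w := w) hV hf hN hA hAD (-1)
  have e1 : D.ballBundle w A ∩ (D.ballBundle w A ∩ D.extremeSet 1) =
      D.ballBundle w A ∩ D.extremeSet 1 := by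
    ext z; simp
  have e2 : D.ballBundle w A \ (D.ballBundle w A ∩ D.extremeSet 1) =
      D.ballBundle w A \ D.extremeSet 1 := by
    ext z; simp
  have e3 : (D.ballBundle w A \ D.extremeSet 1) ∩ (D.ballBundle w A ∩ D.extremeSet (-1)) =
      (D.ballBundle w A ∩ D.extremeSet (-1)) \ D.extremeSet 1 := by
    ext z; simp only [Set.mem_inter_iff, Set.mem_sdiff]; tauto
  have e4 : (D.ballBundle w A \ D.extremeSet 1) \ (D.ballBundle w A ∩ D.extremeSet (-1)) =
      (D.ballBundle w A \ D.extremeSet 1) \ D.extremeSet (-1) := by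
    ext z; simp only [Set.mem_inter_iff, Set.mem_sdiff]; tauto
  rw [← lintegral_inter_add_sdiff J (D.ballBundle w A) h₁,
    ← lintegral_inter_add_sdiff J (D.ballBundle w A \ _) h₂, e1, e2, e3, e4]

/-- If a countable family of sets in adapted charts is mapped by the Gauss maps onto `B` up to a
null set, the integrals of the Jacobian add up to at least the volume of `B`. -/
theorem volume_le_tsum (hV : Module.finrank ℝ V = n + k + 1)
    (hf : ContMDiff (𝓡 n) 𝓘(ℝ, V) ∞ f) (hN : N.Induces Ω E) {x : ℕ → M}
    (D : ∀ i, AdaptedChart N (x i)) {T : ℕ → Set (ConormalModel n k)}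
    (hT : ∀ i, MeasurableSet (T i)) (hTD : ∀ i, T i ⊆ (D i).coordSet (D i).nbhd ×ˢ Set.univ)
    {B Z : Set (ConormalModel n k)} (hZ : volume Z = 0)
    (hB : ∀ y ∈ B, y ∉ Z → ∃ i, ∃ z ∈ T i, (D i).gaussMap w z = y) :
    volume B ≤ ∑' i, ∫⁻ z in T i, ‖(fderiv ℝ ((D i).gaussMap w) z).det‖ₑ := by
  have h1 : B ⊆ (⋃ i, (D i).gaussMap w '' T i) ∪ Z := by
    intro y hy
    by_cases hyZ : y ∈ Z
    · exact Or.inr hyZ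
    · obtain ⟨i, z, hz, rfl⟩ := hB y hy hyZ
      exact Or.inl (Set.mem_iUnion.2 ⟨i, z, hz, rfl⟩)
  calc volume B ≤ volume ((⋃ i, (D i).gaussMap w '' T i) ∪ Z) := measure_mono h1
    _ ≤ volume (⋃ i, (D i).gaussMap w '' T i) + volume Z := measure_union_le _ _
    _ = volume (⋃ i, (D i).gaussMap w '' T i) := by rw [hZ, add_zero]
    _ ≤ ∑' i, volume ((D i).gaussMap w '' T i) := measure_iUnion_le _
    _ ≤ _ := ENNReal.tsum_le_tsum fun i => (D i).volume_image_le hV hf hN (hT i) (hTD i)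

/-- The Gauss map is regular at the non-degenerate conormal functionals. -/
theorem det_fderiv_gaussMap_ne_zero (hV : Module.finrank ℝ V = n + k + 1)
    (hf : ContMDiff (𝓡 n) 𝓘(ℝ, V) ∞ f) (hN : N.Induces Ω E) (hw : Ω w = 1) {c : M}
    (D : AdaptedChart N c) {z : ConormalModel n k} (hz : z.1 ∈ D.coordSet D.nbhd)
    (h : (hessianMatrix D.immersion z.1 (D.functional z)).det ≠ 0) :
    (fderiv ℝ (D.gaussMap w) z).det ≠ 0 := by
  have hΩ : ∀ u ∈ D.coordSet D.nbhd, Ω (adaptedFrame D.immersion D.frame u) ≠ 0 :=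
    fun _ => D.map_adaptedFrame_ne_zero hf hN
  have h1 := abs_det_fderiv_conormalMap hV (D.isOpen_coordSet D.isOpen_nbhd)
    (D.contDiffOn_immersion hf) D.contDiffOn_frame hΩ hw hz
  rw [← abs_ne_zero]
  change |(fderiv ℝ (conormalMap D.immersion D.frame w) z).det| ≠ 0
  rw [h1, abs_ne_zero]
  exact div_ne_zero h (hΩ _ hz)

variable [CompactSpace M]

/-- The lower bound for the total absolute curvature, which is strict as soon as some non-degenerate
conormal functional is not extremal at its base point. -/
theorem lt_lintegral_fibreIntegral (hV : Module.finrank ℝ V = n + k + 1)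
    (hf : ContMDiff (𝓡 n) 𝓘(ℝ, V) ∞ f) (hN : N.Induces Ω E) (S : UnitEllipsoid Ω)
    (hw : Ω w = 1) (hS : ∀ φ, S.sq φ = ∑ l, height Ω φ (w l) ^ 2) {p : M} {l : V →L[ℝ] ℝ}
    (hl : ∀ x, l (df n f p x) = 0) (hl0 : 0 < modelSq (evalFrame w l))
    (hl1 : modelSq (evalFrame w l) < 1)
    (hdet : (hessianMatrix (f ∘ (chartAt (EuclideanSpace ℝ (Fin n)) p).symm)
      (chartAt (EuclideanSpace ℝ (Fin n)) p p) l).det ≠ 0)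
    {q₁ q₂ : M} (hq₁ : l (f q₁) < l (f p)) (hq₂ : l (f p) < l (f q₂)) :
    ((n + k + 1 : ℕ) : ℝ≥0∞) * (2 * volume {y : ConormalModel n k | 0 < modelSq y ∧ modelSq y < 1}) <
      ∫⁻ p, N.fibreIntegral E S p ∂volumeMeasure E.vol := by
  have hw0 : Ω w ≠ 0 := by simp [hw]
  have : Nonempty M := ⟨p⟩
  let D₀ (c : M) : AdaptedChart N c := (N.nonempty_adaptedChart c).some
  -- a countable cover by adapted charts, the first of them around `p`
  obtain ⟨x, hx0, hx⟩ : ∃ x : ℕ → M, x 0 = p ∧ ⋃ i, (D₀ (x i)).nbhd = Set.univ := by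
    obtain ⟨t, ht⟩ := CompactSpace.elim_nhds_subcover (fun c => (D₀ c).nbhd)
      fun c => (D₀ c).isOpen_nbhd.mem_nhds (D₀ c).mem_nbhd
    obtain ⟨y, hy⟩ := (insert p (t : Set M)).toFinite.countable.exists_eq_range
      (Set.insert_nonempty _ _)
    refine ⟨fun i => Nat.casesOn i p y, rfl, Set.eq_univ_of_univ_subset ?_⟩
    intro q _
    obtain ⟨c, hc, hq⟩ := Set.mem_iUnion₂.1 (ht ▸ Set.mem_univ q : q ∈ ⋃ c ∈ t, (D₀ c).nbhd)
    obtain ⟨i, rfl⟩ : c ∈ Set.range y := hy ▸ Set.mem_insert_of_mem _ hc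
    exact Set.mem_iUnion.2 ⟨i + 1, hq⟩
  let D := fun i => D₀ (x i)
  let A : ℕ → Set M := disjointed fun i => (D i).nbhd
  have hAD (i) : A i ⊆ (D i).nbhd := disjointed_subset _ i
  have hA (i) : MeasurableSet (A i) :=
    MeasurableSet.disjointed (fun i => (D i).isOpen_nbhd.measurableSet) i
  have hAu : ⋃ i, A i = Set.univ := by
    rw [← hx]
    exact iUnion_disjointed
  have hA0 : A 0 = (D 0).nbhd := disjointed_zero _
  have hsum : ∫⁻ p, N.fibreIntegral E S p ∂volumeMeasure E.vol =
      ∑' i, ∫⁻ p in A i, N.fibreIntegral E S p ∂volumeMeasure E.vol := by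
    rw [← lintegral_iUnion hA (disjoint_disjointed _), hAu, setLIntegral_univ]
  let J := fun i z => ‖(fderiv ℝ ((D i).gaussMap w) z).det‖ₑ
  set κ := volume {y : ConormalModel n k | 0 < modelSq y ∧ modelSq y < 1} with hκ
  have hκ_fin : κ ≠ ⊤ := by
    rw [hκ, volume_modelSq_lt_one]
    exact measure_ball_lt_top.ne
  -- the maxima
  have hmax : κ ≤ ∑' i, ∫⁻ z in (D i).ballBundle w (A i) ∩ (D i).extremeSet 1, J i z := by
    refine volume_le_tsum hV hf hN D
      (fun i => (D i).measurableSet_inter_extremeSet hV hf hN (hA i) (hAD i) 1)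
      (fun i => Set.inter_subset_left.trans ((D i).ballBundle_subset (hAD i)))
      (measure_empty (μ := volume)) fun y hy _ => ?_
    obtain ⟨l', rfl⟩ := evalFrame_surjective hV hw0 y
    obtain ⟨i, z, hz, hzl⟩ := exists_mem_extremeSet hV hf hN D hAD hAu hy.1 hy.2 one_ne_zero
    exact ⟨i, z, hz, by rw [(D i).gaussMap_eq, hzl]⟩
  -- the minima; a functional whose minimum is a maximum is constant on the image of `f`
  have hmin : κ ≤ ∑' i, ∫⁻ z in
      ((D i).ballBundle w (A i) ∩ (D i).extremeSet (-1)) \ (D i).extremeSet 1, J i z := by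
    have hne : f q₂ - f q₁ ≠ 0 := by
      intro h
      rw [sub_eq_zero.1 h] at hq₂
      exact lt_asymm hq₁ hq₂
    refine volume_le_tsum hV hf hN D (fun i => ?_)
      (fun i => (Set.sdiff_subset.trans Set.inter_subset_left).trans
        ((D i).ballBundle_subset (hAD i)))
      (volume_evalFrame_ker hV hw0 hne) fun y hy hyZ => ?_
    · have h1 := ((D i).measurableSet_inter_extremeSet (w := w) hV hf hN (hA i) (hAD i) (-1)).diff
        ((D i).measurableSet_inter_extremeSet (w := w) hV hf hN (hA i) (hAD i) 1)
      convert h1 using 1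
      ext z
      simp only [Set.mem_inter_iff, Set.mem_sdiff]
      tauto
    · obtain ⟨l', rfl⟩ := evalFrame_surjective hV hw0 y
      obtain ⟨i, z, hz, hzl⟩ := exists_mem_extremeSet hV hf hN D hAD hAu hy.1 hy.2
        (neg_ne_zero.2 one_ne_zero)
      refine ⟨i, z, ⟨hz, fun hz1 => hyZ ⟨l', ?_, rfl⟩⟩, by rw [(D i).gaussMap_eq, hzl]⟩
      have hconst (q : M) : l' (f q) = l' ((D i).immersion z.1) := by
        have h1 := hz1 q
        have h2 := hz.2 q
        rw [hzl] at h1 h2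
        linarith
      simp [hconst]
  -- the given functional
  have hmid : 0 < ∑' i, ∫⁻ z in
      ((D i).ballBundle w (A i) \ (D i).extremeSet 1) \ (D i).extremeSet (-1), J i z := by
    refine lt_of_lt_of_le ?_ (ENNReal.le_tsum 0)
    rw [hA0]
    have key : ∀ c, c = p → ∀ D : AdaptedChart N c, 0 < ∫⁻ z in
        (D.ballBundle w D.nbhd \ D.extremeSet 1) \ D.extremeSet (-1),
          ‖(fderiv ℝ (D.gaussMap w) z).det‖ₑ := by
      rintro c rfl D
      set e := chartAt (EuclideanSpace ℝ (Fin n)) c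
      have hcs : c ∈ e.source := D.nbhd_subset D.mem_nbhd
      have hfun := D.functional_eq hV hf hN D.mem_nbhd hl
      have hz : e c ∈ D.coordSet D.nbhd := ⟨e.map_source hcs, by
        rw [Set.mem_preimage, e.left_inv hcs]
        exact D.mem_nbhd⟩
      have himm : D.immersion (e c) = f c := congrArg f (e.left_inv hcs)
      refine D.lintegral_pos hV hf hN (z := (e c, fun j => l (D.frame j (e c))))
        ⟨hz, by rwa [D.gaussMap_eq, hfun], by rwa [D.gaussMap_eq, hfun]⟩ (fun h => ?_)
        (fun h => ?_) (det_fderiv_gaussMap_ne_zero hV hf hN hw D hz (by rwa [hfun]))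
      · have h1 := h q₂
        rw [hfun, himm] at h1
        linarith
      · have h1 := h q₁
        rw [hfun, himm] at h1
        linarith
    exact key _ hx0 (D 0)
  calc ((n + k + 1 : ℕ) : ℝ≥0∞) * (2 * κ)
      < ((n + k + 1 : ℕ) : ℝ≥0∞) * ∑' i, ∫⁻ z in (D i).ballBundle w (A i), J i z := by
        refine (ENNReal.mul_lt_mul_iff_right (by simp) (ENNReal.natCast_ne_top _)).2 ?_
        simp only [fun i => (D i).lintegral_eq_add (w := w) hV hf hN (hA i) (hAD i) (J i)]
        rw [ENNReal.tsum_add, ENNReal.tsum_add, two_mul, ← add_assoc]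
        exact (ENNReal.lt_add_right (by simp [hκ_fin]) hmid.ne').trans_le
          (add_le_add_left (add_le_add hmax hmin) _)
    _ = ∑' i, ((n + k + 1 : ℕ) : ℝ≥0∞) * ∫⁻ z in (D i).ballBundle w (A i), J i z :=
        ENNReal.tsum_mul_left.symm
    _ ≤ ∑' i, ∫⁻ p in A i, N.fibreIntegral E S p ∂volumeMeasure E.vol :=
        ENNReal.tsum_le_tsum fun i => (D i).lintegral_det_le hV hf hN S hw hS (hA i) (hAD i)
    _ = _ := hsum.symm

end LowerBound

/-! ### Rigidity -/

section LinearAlgebra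

theorem eventually_det_add_smul_ne_zero {n : ℕ} (A B : Matrix (Fin n) (Fin n) ℝ)
    (hA : A.det ≠ 0) : ∀ᶠ t in nhdsWithin (0 : ℝ) {0}ᶜ, (B + t • A).det ≠ 0 := by
  set P : Polynomial ℝ :=
    (((Polynomial.X : Polynomial ℝ) • A.map Polynomial.C + B.map Polynomial.C)).det with hP
  have hP0 : P ≠ 0 := by
    intro h
    have h1 := Polynomial.coeff_det_X_add_C_card A B
    rw [← hP, h, Polynomial.coeff_zero] at h1
    exact hA h1.symm
  have heval (t : ℝ) : P.eval t = (B + t • A).det := by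
    rw [hP, ← Polynomial.coe_evalRingHom, RingHom.map_det]
    congr 1
    ext i j
    simp only [RingHom.mapMatrix_apply, Matrix.map_apply, Matrix.add_apply, Matrix.smul_apply,
      smul_eq_mul, Polynomial.coe_evalRingHom, Polynomial.eval_add, Polynomial.eval_mul,
      Polynomial.eval_X, Polynomial.eval_C, add_comm]
  have hfin := (Polynomial.finite_setOfPred_isRoot hP0)
  have h2 : ∀ᶠ t in nhds (0 : ℝ), t ∉ {t | P.IsRoot t} \ {0} :=
    (hfin.subset Set.sdiff_subset).isClosed.isOpen_compl.mem_nhds (by simp)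
  filter_upwards [nhdsWithin_le_nhds h2, self_mem_nhdsWithin] with t ht ht0 h3
  exact ht ⟨(heval t).trans h3, ht0⟩

/-- A family of points lies in an affine subspace of dimension `dim K + 1` containing `x₀ + K`, if
no functional that vanishes on `K` takes both larger and smaller values on it than at `x₀`. -/
theorem exists_affineSubspace {V ι : Type*} [AddCommGroup V] [Module ℝ V] [FiniteDimensional ℝ V]
    {n : ℕ} (f : ι → V) (x₀ : V) (K : Submodule ℝ V) (hK : Module.finrank ℝ K = n)
    (hV : n < Module.finrank ℝ V)
    (h : ∀ l : V →ₗ[ℝ] ℝ, (∀ x ∈ K, l x = 0) → ∀ q₁ q₂, ¬(l (f q₁) < l x₀ ∧ l x₀ < l (f q₂))) :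
    ∃ L : AffineSubspace ℝ V, (L : Set V).Nonempty ∧ Module.finrank ℝ L.direction = n + 1 ∧
      Set.range f ⊆ L := by
  obtain ⟨v, hvK, hv⟩ : ∃ v, v ∉ K ∧ ((∃ q, v = f q - x₀) ∨ ∀ q, f q - x₀ ∈ K) := by
    by_cases hall : ∀ q, f q - x₀ ∈ K
    · obtain ⟨v, hv⟩ : ∃ v, v ∉ K := by
        by_contra! hcon
        rw [(Submodule.eq_top_iff'.2 hcon), finrank_top] at hK
        exact hV.ne' hK
      exact ⟨v, hv, Or.inr hall⟩
    · push Not at hall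
      obtain ⟨q, hq⟩ := hall
      exact ⟨_, hq, Or.inl ⟨q, rfl⟩⟩
  refine ⟨AffineSubspace.mk' x₀ (K ⊔ Submodule.span ℝ {v}), ⟨x₀, by simp⟩, ?_, ?_⟩
  · rw [AffineSubspace.direction_mk']
    rw [Submodule.finrank_sup_span_singleton hvK, hK]
  · rintro _ ⟨q, rfl⟩
    rw [SetLike.mem_coe, AffineSubspace.mem_mk', vsub_eq_sub]
    by_contra hq
    have hqK : f q - x₀ ∉ K := fun hqK => hq (Submodule.mem_sup_left hqK)
    obtain ⟨q₀, rfl⟩ := hv.resolve_right fun hall => hqK (hall q)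
    obtain ⟨l₁, hl₁, hl₁K⟩ := Submodule.exists_le_ker_of_notMem hq
    obtain ⟨l₂, hl₂, hl₂K⟩ := Submodule.exists_le_ker_of_notMem hvK
    -- a functional with values `1` and `-1` at the two vectors
    let l : V →ₗ[ℝ] ℝ := (l₂ (f q₀ - x₀))⁻¹ • l₂ +
      ((-1 - (l₂ (f q₀ - x₀))⁻¹ * l₂ (f q - x₀)) / l₁ (f q - x₀)) • l₁
    have h1 : l₁ (f q₀ - x₀) = 0 :=
      hl₁K (Submodule.mem_sup_right (Submodule.mem_span_singleton_self _))
    have h2 : l (f q₀ - x₀) = 1 := by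
      simp only [l, LinearMap.add_apply, LinearMap.smul_apply, h1, smul_eq_mul, mul_zero, add_zero]
      exact inv_mul_cancel₀ hl₂
    have h3 : l (f q - x₀) = -1 := by
      simp only [l, LinearMap.add_apply, LinearMap.smul_apply, smul_eq_mul]
      rw [div_mul_cancel₀ _ hl₁]
      ring
    refine h l (fun x hx => ?_) q q₀ ⟨?_, ?_⟩
    · have h4 : l₁ x = 0 := hl₁K (Submodule.mem_sup_left hx)
      have h5 : l₂ x = 0 := hl₂K hx
      simp [l, h4, h5]
    · rw [map_sub] at h3
      linarith
    · rw [map_sub] at h2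
      linarith

end LinearAlgebra

section Rigidity

open MeasureTheory

variable {n : ℕ} {M : Type*} [TopologicalSpace M] [ChartedSpace (EuclideanSpace ℝ (Fin n)) M]
  [IsManifold (𝓡 n) ∞ M] {V : Type*} [NormedAddCommGroup V] [NormedSpace ℝ V] {k : ℕ} {f : M → V}
  {Ω : V [⋀^Fin (n + k + 1)]→ₗ[ℝ] ℝ} {E : EquiaffineStructure n M}
  {N : TransversalBundle n f k} [MeasurableSpace M]

theorem exists_lipschitzKilling_ne_zero (S : UnitEllipsoid Ω)
    (hτ : N.totalAbsoluteCurvature E S = 2) : ∃ p a, N.lipschitzKilling E Ω p (N.coord p a) ≠ 0 := by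
  by_contra! h
  simp [TransversalBundle.totalAbsoluteCurvature, h] at hτ

theorem lintegral_fibreIntegral_eq (S : UnitEllipsoid Ω)
    (hτ : N.totalAbsoluteCurvature E S = 2) :
    ∫⁻ p, N.fibreIntegral E S p ∂volumeMeasure E.vol = ((n + k + 1 : ℕ) : ℝ≥0∞) *
      (2 * volume {y : ConormalModel n k | 0 < modelSq y ∧ modelSq y < 1}) := by
  have hfin : volume (Metric.ball (0 : EuclideanSpace ℝ (Fin (n + k + 1))) 1) ≠ ⊤ :=
    measure_ball_lt_top.ne
  have hpos : volume (Metric.ball (0 : EuclideanSpace ℝ (Fin (n + k + 1))) 1) ≠ 0 :=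
    (Metric.measure_ball_pos _ _ one_pos).ne'
  rw [TransversalBundle.totalAbsoluteCurvature, Measure.toSphere_apply_univ,
    finrank_euclideanSpace_fin, eq_comm, ENNReal.eq_div_iff (mul_ne_zero (by simp) hpos)
      (ENNReal.mul_ne_top (ENNReal.natCast_ne_top _) hfin)] at hτ
  rw [volume_modelSq_lt_one, mul_comm 2, ← mul_assoc]
  exact hτ.symm

theorem hessianMatrix_add_smul (g : EuclideanSpace ℝ (Fin n) → V) (u : EuclideanSpace ℝ (Fin n))
    (l l' : V →L[ℝ] ℝ) (t : ℝ) : hessianMatrix g u (l + t • l' : V →L[ℝ] ℝ) =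
      hessianMatrix g u l + t • hessianMatrix g u l' := by
  ext i j
  simp [hessianMatrix]

variable [FiniteDimensional ℝ V] [T2Space M] [BorelSpace M] [CompactSpace M]

/-- If the total absolute curvature is `2`, a non-degenerate conormal functional is extremal at its
base point. -/
theorem not_lt_and_lt_of_det_ne_zero (hV : Module.finrank ℝ V = n + k + 1)
    (hf : ContMDiff (𝓡 n) 𝓘(ℝ, V) ∞ f) (hN : N.Induces Ω E) (hΩ : Ω ≠ 0) (S : UnitEllipsoid Ω)
    (hτ : N.totalAbsoluteCurvature E S = 2) {p : M} {l : V →L[ℝ] ℝ}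
    (hl : ∀ x, l (df n f p x) = 0)
    (hdet : (hessianMatrix (f ∘ (chartAt (EuclideanSpace ℝ (Fin n)) p).symm)
      (chartAt (EuclideanSpace ℝ (Fin n)) p p) l).det ≠ 0) (q₁ q₂ : M) :
    ¬(l (f q₁) < l (f p) ∧ l (f p) < l (f q₂)) := by
  rintro ⟨h₁, h₂⟩
  obtain ⟨w, hw, hS⟩ := S.exists_sq_eq hΩ
  have hm : 0 < modelSq (evalFrame w l) := by
    rw [modelSq_evalFrame]
    refine (Finset.sum_nonneg fun i _ => sq_nonneg _).lt_of_ne' fun h0 => ?_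
    rw [Finset.sum_eq_zero_iff_of_nonneg fun i _ => sq_nonneg _] at h0
    have h3 : evalFrame w l = evalFrame w 0 :=
      (modelBasis n k).repr.injective (Finsupp.ext fun i => by
        rw [modelBasis_repr_evalFrame, modelBasis_repr_evalFrame]
        simpa using h0 (frameIndex n k i) (Finset.mem_univ _))
    rw [evalFrame_injective hV (hw.trans_ne one_ne_zero) h3] at h₁
    simp at h₁
  -- rescale the functional into the unit ball
  set m := modelSq (evalFrame w l) with hm_def
  set t := (m + 1)⁻¹ with ht_def
  have ht : 0 < t := by positivity
  have hsq : modelSq (evalFrame w (t • l)) = t ^ 2 * m := by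
    rw [hm_def, modelSq_evalFrame, modelSq_evalFrame, Finset.mul_sum]
    exact Finset.sum_congr rfl fun i _ => by simp [mul_pow]
  have hdet' : (hessianMatrix (f ∘ (chartAt (EuclideanSpace ℝ (Fin n)) p).symm)
      (chartAt (EuclideanSpace ℝ (Fin n)) p p) (t • l : V →L[ℝ] ℝ)).det ≠ 0 := by
    have h3 := hessianMatrix_add_smul (f ∘ (chartAt (EuclideanSpace ℝ (Fin n)) p).symm)
      (chartAt (EuclideanSpace ℝ (Fin n)) p p) 0 l t
    have h4 : hessianMatrix (f ∘ (chartAt (EuclideanSpace ℝ (Fin n)) p).symm)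
      (chartAt (EuclideanSpace ℝ (Fin n)) p p) (0 : V →L[ℝ] ℝ) = 0 := by
      ext i j
      simp [hessianMatrix]
    rw [zero_add, h4, zero_add] at h3
    rw [h3, Matrix.det_smul]
    exact mul_ne_zero (pow_ne_zero _ ht.ne') hdet
  have hlt := lt_lintegral_fibreIntegral hV hf hN S hw hS (l := t • l)
    (fun x => by simp [hl]) (by rw [hsq]; positivity) (by
      rw [hsq, ht_def, inv_pow, inv_mul_lt_iff₀ (by positivity)]
      nlinarith) hdet' (q₁ := q₁) (q₂ := q₂) (by simpa using mul_lt_mul_of_pos_left h₁ ht)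
    (by simpa using mul_lt_mul_of_pos_left h₂ ht)
  rw [lintegral_fibreIntegral_eq S hτ] at hlt
  exact lt_irrefl _ hlt

/-- If the total absolute curvature is `2`, then at some point all conormal functionals are
extremal: the non-degenerate ones are dense as soon as there is one. -/
theorem exists_forall_not_lt_and_lt (hV : Module.finrank ℝ V = n + k + 1)
    (hf : ContMDiff (𝓡 n) 𝓘(ℝ, V) ∞ f) (hN : N.Induces Ω E) (hΩ : Ω ≠ 0) (S : UnitEllipsoid Ω)
    (hτ : N.totalAbsoluteCurvature E S = 2) : ∃ p : M, ∀ l : V →L[ℝ] ℝ,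
      (∀ x, l (df n f p x) = 0) → ∀ q₁ q₂, ¬(l (f q₁) < l (f p) ∧ l (f p) < l (f q₂)) := by
  obtain ⟨p, a, hpa⟩ := exists_lipschitzKilling_ne_zero S hτ
  refine ⟨p, fun l hl q₁ q₂ ⟨h₁, h₂⟩ => ?_⟩
  set e := chartAt (EuclideanSpace ℝ (Fin n)) p
  have hp : p ∈ e.source := mem_chart_source _ p
  let l₀ : V →L[ℝ] ℝ := LinearMap.toContinuousLinearMap (N.coordHeight E Ω p a)
  have hl₀ (x) : l₀ (df n f p x) = 0 := N.height_gauss_coord_df E Ω p a x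
  have hdet₀ : (hessianMatrix (f ∘ e.symm) (e p) l₀).det ≠ 0 := by
    have h3 : ∀ q, q = p → N.lipschitzKilling E Ω q (N.coord q a) ≠ 0 := by
      rintro q rfl
      exact hpa
    have h4 := N.lipschitzKilling_ne_zero hf E Ω p (e.map_source hp) (h3 _ (e.left_inv hp))
    have h5 : ∀ q, q = p → (hessianMatrix (f ∘ e.symm) (e p) (N.coordHeight E Ω q a)).det ≠ 0 →
        (hessianMatrix (f ∘ e.symm) (e p) l₀).det ≠ 0 := by
      rintro q rfl h
      exact h
    exact h5 _ (e.left_inv hp) h4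
  have hev := eventually_det_add_smul_ne_zero _ (hessianMatrix (f ∘ e.symm) (e p) l) hdet₀
  have hcont (q : M) : Continuous fun t : ℝ => (l + t • l₀) (f q) := by
    simp only [add_apply, smul_apply]
    fun_prop
  have hev₁ : ∀ᶠ t in nhds (0 : ℝ), (l + t • l₀) (f q₁) < (l + t • l₀) (f p) :=
    (hcont q₁).continuousAt.eventually_lt (hcont p).continuousAt (by simpa using h₁)
  have hev₂ : ∀ᶠ t in nhds (0 : ℝ), (l + t • l₀) (f p) < (l + t • l₀) (f q₂) :=
    (hcont p).continuousAt.eventually_lt (hcont q₂).continuousAt (by simpa using h₂)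
  obtain ⟨t, ht, ht₁, ht₂⟩ := (hev.and (nhdsWithin_le_nhds (hev₁.and hev₂))).exists
  exact not_lt_and_lt_of_det_ne_zero hV hf hN hΩ S hτ (fun x => by simp [hl, hl₀])
    (by rwa [hessianMatrix_add_smul]) q₁ q₂ ⟨ht₁, ht₂⟩

end Rigidity

end EquiaffineGeometry

end

theorem theorem3p4 {n k : ℕ} {M : Type*} [TopologicalSpace M] [T2Space M] [CompactSpace M]
    [ChartedSpace (EuclideanSpace ℝ (Fin n)) M] [IsManifold (𝓡 n) ∞ M]
    [MeasurableSpace M] [BorelSpace M]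
    (E : EquiaffineStructure n M)
    (Ω : EuclideanSpace ℝ (Fin (n + k + 1)) [⋀^Fin (n + k + 1)]→ₗ[ℝ] ℝ) (hΩ : Ω ≠ 0)
    (f : M → EuclideanSpace ℝ (Fin (n + k + 1)))
    (hf : IsEquiaffineImmersion f Ω E)
    (N : TransversalBundle n f k) (hN : N.Induces Ω E)
    (S : UnitEllipsoid Ω)
    (hτ : N.totalAbsoluteCurvature E S = 2) :
    ∃ L : AffineSubspace ℝ (EuclideanSpace ℝ (Fin (n + k + 1))),
      (L : Set (EuclideanSpace ℝ (Fin (n + k + 1)))).Nonempty ∧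
        Module.finrank ℝ L.direction = n + 1 ∧ Set.range f ⊆ L := by
  obtain ⟨p, hp⟩ := exists_forall_not_lt_and_lt finrank_euclideanSpace_fin hf.smooth hN hΩ S hτ
  refine exists_affineSubspace f (f p) (LinearMap.range (df n f p))
    ((LinearMap.finrank_range_of_inj (hf.injective_df p)).trans (finrank_tangentSpace p))
    (by rw [finrank_euclideanSpace_fin]; omega) fun l hl q₁ q₂ => ?_
  exact hp (LinearMap.toContinuousLinearMap l) (fun x => hl _ ⟨x, rfl⟩) q₁ q₂
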